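/- Identify the dual group of $\mathbb{R}^d$ with $\mathbb{R}^d$ through the characters $x\mapsto e^{2\pi i\langle x,\xi\rangle}$, use Lebesgue measure on both sides, and write $\widecheck f(\xi)=\int_{\mathbb{R}^d} f(x)e^{2\pi i\langle x,\xi\rangle}\,dx$, $\widetilde f(x)=\overline{f(-x)}$ and $f^\dagger(x)=f(-x)$ for $f\in C_c(\mathbb{R}^d)$ (continuous, complex-valued, compactly supported). Let $\mathcal M(\mathbb{R}^d)$ be the space of complex (regular) Radon measures on $\mathbb{R}^d$, i.e. linear functionals $\mu$ on $C_c(\mathbb{R}^d)$ such that for every compact $K$ there is $C$ with $|\mu(f)|\le C\|f\|_\infty$ for all $f$ supported in $K$. Let $|\mu|$ be the variation measure of $\mu$, i.e. the positive Radon measure with $|\mu|(f)=\sup\{|\mu(g)| : g\in C_c(\mathbb{R}^d),\ |g|\le f\}$ for $0\le f\in C_c(\mathbb{R}^d)$; write $\langle\mu,f\rangle$ for $\mu(f)$ and for its continuous extension to $f\in L^1(|\mu|)$, and define $\mu^\dagger$ by $\langle\mu^\dagger,f\rangle=\langle\mu,f^\dagger\rangle$ for $f\in C_c(\mathbb{R}^d)$.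 The measure $\mu$ is translation bounded if $\sup_{t\in\mathbb{R}^d}|\mu|(t+K)<\infty$ for every compact $K\subset\mathbb{R}^d$. It is transformable if there is a measure $\widehat\mu\in\mathcal M(\mathbb{R}^d)$ such that for all $f\in C_c(\mathbb{R}^d)$ we have $\widecheck f\in L^2(|\widehat\mu|)$ and $$\langle\mu,f*\widetilde f\rangle=\langle\widehat\mu,|\widecheck f|^2\rangle .$$ Such a measure $\widehat\mu$, if it exists, is unique; it is called the Fourier transform of $\mu$. Theorem. Let $\mu\in\mathcal M(\mathbb{R}^d)$ be transformable. Then $\widehat\mu$ is transformable if and only if $\mu$ is translation bounded. If either of these conditions holds, then $\widehat{\widehat\mu}=\mu^\dagger$. Consequently, the Fourier transform $\mu\mapsto\widehat\mu$ is a bijection from the space of translation bounded transformable measures on $\mathbb{R}^d$ onto itself. -/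

import Mathlib

open MeasureTheory Filter Topology
open scoped NNReal ENNReal CompactlySupported FourierTransform

noncomputable section

/-- A complex (regular) Radon measure on a locally compact space `X`: a linear functional `μ` on
the space `C_c(X, ℂ)` which is continuous in the inductive limit topology, that is, for every
compact `K` there is a constant `C` with `|μ(f)| ≤ C ‖f‖_∞` for all `f` supported in `K`.
The value `⟨μ, f⟩` for `f` in `C_c(X, ℂ)` is written `μ f`. -/
structure ComplexRadonMeasure (X : Type*) [TopologicalSpace X] extends
    C_c(X, ℂ) →ₗ[ℂ] ℂ where
  bounded_on_compact : ∀ K : Set X, IsCompact K → ∃ C : ℝ≥0, ∀ f : C_c(X, ℂ),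
    tsupport f ⊆ K → ∀ B : ℝ≥0, (∀ x, ‖f x‖₊ ≤ B) → ‖toFun f‖₊ ≤ C * B

namespace ComplexRadonMeasure

section Variation

variable {X : Type*} [TopologicalSpace X]

instance : CoeFun (ComplexRadonMeasure X) (fun _ => C_c(X, ℂ) → ℂ) :=
  ⟨fun μ => μ.toLinearMap⟩

lemma nnnorm_coe_nnreal (r : ℝ≥0) : ‖((r : ℝ) : ℂ)‖₊ = r := by
  ext; simp

/-- The set of all `|μ(g)|` where `g` in `C_c(X, ℂ)` satisfies `|g| ≤ f`. -/
def variationSet (μ : ComplexRadonMeasure X) (f : C_c(X, ℝ≥0)) : Set ℝ≥0 :=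
  {r | ∃ g : C_c(X, ℂ), (∀ x, ‖g x‖₊ ≤ f x) ∧ r = ‖μ g‖₊}

lemma variationSet_nonempty (μ : ComplexRadonMeasure X) (f : C_c(X, ℝ≥0)) :
    (μ.variationSet f).Nonempty := ⟨‖μ 0‖₊, 0, by simp, rfl⟩

lemma tsupport_subset_of_le {f : C_c(X, ℝ≥0)} {g : C_c(X, ℂ)} (h : ∀ x, ‖g x‖₊ ≤ f x) :
    tsupport g ⊆ tsupport f := by
  apply closure_mono
  intro x hx hfx
  apply hx
  have := h x
  rw [hfx] at this
  simpa using this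

lemma variationSet_bddAbove (μ : ComplexRadonMeasure X) (f : C_c(X, ℝ≥0)) :
    BddAbove (μ.variationSet f) := by
  obtain ⟨C, hC⟩ := μ.bounded_on_compact (tsupport f) f.hasCompactSupport
  obtain ⟨B, hB⟩ : ∃ B : ℝ≥0, ∀ x, f x ≤ B := by
    obtain ⟨B, hB⟩ := (f.hasCompactSupport.isCompact_range f.continuous).bddAbove
    exact ⟨B, fun x => hB ⟨x, rfl⟩⟩
  refine ⟨C * B, ?_⟩
  rintro r ⟨g, hg, rfl⟩
  exact hC g (tsupport_subset_of_le hg) B fun x => (hg x).trans (hB x)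

/-- The variation of `μ` on nonnegative functions: `|μ|(f) = sup { |μ(g)| : |g| ≤ f }`. -/
def variationFun (μ : ComplexRadonMeasure X) (f : C_c(X, ℝ≥0)) : ℝ≥0 :=
  sSup (μ.variationSet f)

lemma le_variationFun (μ : ComplexRadonMeasure X) {f : C_c(X, ℝ≥0)} {g : C_c(X, ℂ)}
    (h : ∀ x, ‖g x‖₊ ≤ f x) : ‖μ g‖₊ ≤ μ.variationFun f :=
  le_csSup (μ.variationSet_bddAbove f) ⟨g, h, rfl⟩

lemma variationFun_le (μ : ComplexRadonMeasure X) {f : C_c(X, ℝ≥0)} {c : ℝ≥0}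
    (h : ∀ g : C_c(X, ℂ), (∀ x, ‖g x‖₊ ≤ f x) → ‖μ g‖₊ ≤ c) : μ.variationFun f ≤ c := by
  apply csSup_le (μ.variationSet_nonempty f)
  rintro r ⟨g, hg, rfl⟩
  exact h g hg

/-- Multiplication by a phase makes `μ g` equal to its absolute value. -/
lemma exists_phase (μ : ComplexRadonMeasure X) (g : C_c(X, ℂ)) :
    ∃ g' : C_c(X, ℂ), (∀ x, ‖g' x‖₊ = ‖g x‖₊) ∧ μ g' = ((‖μ g‖₊ : ℝ) : ℂ) := by
  by_cases h : μ g = 0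
  · exact ⟨g, fun _ => rfl, by simp [h]⟩
  · have h0 : ‖μ g‖ ≠ 0 := norm_ne_zero_iff.mpr h
    refine ⟨(((‖μ g‖ : ℝ) : ℂ) / μ g) • g, fun x => ?_, ?_⟩
    · ext
      simp [h0]
    · rw [map_smul, smul_eq_mul, div_mul_cancel₀ _ h, coe_nnnorm]

/-- The part `g f / (f + f')` of a function `g` with `|g| ≤ f + f'`. -/
lemma exists_part (f f' : C_c(X, ℝ≥0)) (g : C_c(X, ℂ)) (hg : ∀ x, ‖g x‖₊ ≤ f x + f' x) :
    ∃ g₁ : C_c(X, ℂ), (∀ x, ‖g₁ x‖₊ ≤ f x) ∧ (∀ x, ‖g x - g₁ x‖₊ ≤ f' x) := by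
  have key : ∀ x, ‖g x * (((f x / (f x + f' x) : ℝ≥0) : ℝ) : ℂ)‖₊ ≤ ‖g x‖₊ := by
    intro x
    rw [nnnorm_mul]
    have : ‖(((f x / (f x + f' x) : ℝ≥0) : ℝ) : ℂ)‖₊ = f x / (f x + f' x) :=
      nnnorm_coe_nnreal _
    rw [this]
    exact mul_le_of_le_one_right' (div_le_one_of_le₀ le_self_add zero_le)
  have hcont : Continuous fun x => g x * (((f x / (f x + f' x) : ℝ≥0) : ℝ) : ℂ) := by
    rw [continuous_iff_continuousAt]
    intro x
    by_cases hx : f x + f' x = 0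
    · have hgx : g x = 0 := by
        have := hg x
        rw [hx] at this
        simpa using this
      have hgt : Tendsto (fun y => ‖g y‖) (𝓝 x) (𝓝 0) := by
        have := (map_continuous g).norm.tendsto x
        simpa [hgx] using this
      rw [ContinuousAt, hgx, zero_mul]
      exact squeeze_zero_norm (fun y => by exact_mod_cast key y) hgt
    · refine (map_continuous g).continuousAt.mul ?_
      refine Complex.continuous_ofReal.continuousAt.comp
        (NNReal.continuous_coe.continuousAt.comp ?_)
      exact (map_continuous f).continuousAt.div
        ((map_continuous f).add (map_continuous f')).continuousAt hx
  refine ⟨⟨⟨_, hcont⟩, g.hasCompactSupport.mul_right⟩, fun x => ?_, fun x => ?_⟩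
  · change ‖g x * (((f x / (f x + f' x) : ℝ≥0) : ℝ) : ℂ)‖₊ ≤ f x
    by_cases hx : f x + f' x = 0
    · have hf : f x = 0 := (add_eq_zero.mp hx).1
      simp [hf]
    · rw [nnnorm_mul]
      have : ‖(((f x / (f x + f' x) : ℝ≥0) : ℝ) : ℂ)‖₊ = f x / (f x + f' x) :=
        nnnorm_coe_nnreal _
      rw [this]
      calc ‖g x‖₊ * (f x / (f x + f' x)) ≤ (f x + f' x) * (f x / (f x + f' x)) := by
            gcongr; exact hg x
        _ = f x := mul_div_cancel₀ _ hx
  · change ‖g x - g x * (((f x / (f x + f' x) : ℝ≥0) : ℝ) : ℂ)‖₊ ≤ f' x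
    by_cases hx : f x + f' x = 0
    · have hgx : g x = 0 := by
        have := hg x
        rw [hx] at this
        simpa using this
      simp [hgx]
    · have h1 : g x - g x * (((f x / (f x + f' x) : ℝ≥0) : ℝ) : ℂ) =
          g x * (((f' x / (f x + f' x) : ℝ≥0) : ℝ) : ℂ) := by
        have hx' : ((f x : ℝ) : ℂ) + ((f' x : ℝ) : ℂ) ≠ 0 := by exact_mod_cast hx
        push_cast
        field_simp
        ring
      rw [h1, nnnorm_mul]
      have : ‖(((f' x / (f x + f' x) : ℝ≥0) : ℝ) : ℂ)‖₊ = f' x / (f x + f' x) :=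
        nnnorm_coe_nnreal _
      rw [this]
      calc ‖g x‖₊ * (f' x / (f x + f' x)) ≤ (f x + f' x) * (f' x / (f x + f' x)) := by
            gcongr; exact hg x
        _ = f' x := mul_div_cancel₀ _ hx

lemma variationFun_add (μ : ComplexRadonMeasure X) (f f' : C_c(X, ℝ≥0)) :
    μ.variationFun (f + f') = μ.variationFun f + μ.variationFun f' := by
  apply le_antisymm
  · refine μ.variationFun_le fun g hg => ?_
    obtain ⟨g₁, h₁, h₂⟩ := exists_part f f' g hg
    have hsum : μ g = μ g₁ + μ (g - g₁) := by
      rw [← map_add, add_sub_cancel]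
    rw [hsum]
    exact (nnnorm_add_le _ _).trans (add_le_add (μ.le_variationFun h₁) (μ.le_variationFun h₂))
  · have key : ∀ g g' : C_c(X, ℂ), (∀ x, ‖g x‖₊ ≤ f x) → (∀ x, ‖g' x‖₊ ≤ f' x) →
        ‖μ g‖₊ + ‖μ g'‖₊ ≤ μ.variationFun (f + f') := by
      intro g g' hg hg'
      obtain ⟨p, hp, hp'⟩ := μ.exists_phase g
      obtain ⟨q, hq, hq'⟩ := μ.exists_phase g'
      have h1 : ‖μ (p + q)‖₊ = ‖μ g‖₊ + ‖μ g'‖₊ := by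
        rw [map_add, hp', hq', ← Complex.ofReal_add, ← NNReal.coe_add]
        exact nnnorm_coe_nnreal _
      rw [← h1]
      refine μ.le_variationFun fun x => (nnnorm_add_le (p x) (q x)).trans ?_
      rw [hp, hq]
      exact add_le_add (hg x) (hg' x)
    have step : ∀ g : C_c(X, ℂ), (∀ x, ‖g x‖₊ ≤ f x) →
        ‖μ g‖₊ + μ.variationFun f' ≤ μ.variationFun (f + f') := by
      intro g hg
      have h0 : ‖μ g‖₊ ≤ μ.variationFun (f + f') :=
        le_self_add.trans (key g 0 hg (by simp))
      rw [← le_tsub_iff_left h0]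
      refine μ.variationFun_le fun g' hg' => ?_
      rw [le_tsub_iff_left h0]
      exact key g g' hg hg'
    have h1 : μ.variationFun f' ≤ μ.variationFun (f + f') :=
      le_add_self.trans (step 0 (by simp))
    rw [← le_tsub_iff_right h1]
    refine μ.variationFun_le fun g hg => ?_
    rw [le_tsub_iff_right h1]
    exact step g hg

lemma variationFun_smul_le (μ : ComplexRadonMeasure X) (c : ℝ≥0) (hc : c ≠ 0)
    (f : C_c(X, ℝ≥0)) : μ.variationFun (c • f) ≤ c * μ.variationFun f := by
  refine μ.variationFun_le fun g hg => ?_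
  have hc' : ((c : ℝ) : ℂ) ≠ 0 := by exact_mod_cast hc
  have h1 : μ g = ((c : ℝ) : ℂ) * μ ((((c : ℝ) : ℂ))⁻¹ • g) := by
    rw [map_smul, smul_eq_mul, mul_inv_cancel_left₀ hc']
  have h2 : ‖((c : ℝ) : ℂ)‖₊ = c := nnnorm_coe_nnreal c
  rw [h1, nnnorm_mul, h2]
  gcongr
  refine μ.le_variationFun fun x => ?_
  have h3 : ‖g x‖₊ ≤ c * f x := hg x
  change ‖(((c : ℝ) : ℂ))⁻¹ * g x‖₊ ≤ f x
  rw [nnnorm_mul, nnnorm_inv, h2]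
  exact (inv_mul_le_iff₀ (pos_iff_ne_zero.mpr hc)).mpr h3

lemma variationFun_smul (μ : ComplexRadonMeasure X) (c : ℝ≥0) (f : C_c(X, ℝ≥0)) :
    μ.variationFun (c • f) = c * μ.variationFun f := by
  by_cases hc : c = 0
  · subst hc
    have h := μ.variationFun_add 0 0
    rw [add_zero] at h
    rw [zero_smul, zero_mul]
    exact (left_eq_add.mp h)
  · refine le_antisymm (μ.variationFun_smul_le c hc f) ?_
    have h := μ.variationFun_smul_le c⁻¹ (inv_ne_zero hc) (c • f)
    rw [smul_smul, inv_mul_cancel₀ hc, one_smul] at h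
    calc c * μ.variationFun f ≤ c * (c⁻¹ * μ.variationFun (c • f)) := by gcongr
      _ = μ.variationFun (c • f) := mul_inv_cancel_left₀ hc _

/-- The positive linear functional `|μ|` on nonnegative functions. -/
def variationLinear (μ : ComplexRadonMeasure X) : C_c(X, ℝ≥0) →ₗ[ℝ≥0] ℝ≥0 where
  toFun := μ.variationFun
  map_add' := μ.variationFun_add
  map_smul' := μ.variationFun_smul

variable [T2Space X] [LocallyCompactSpace X] [MeasurableSpace X] [BorelSpace X]

/-- The variation measure `|μ|`: the regular Borel measure that represents the positive linear
functional `f ↦ sup { |μ(g)| : |g| ≤ f }`. -/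
def variation (μ : ComplexRadonMeasure X) : Measure X :=
  NNRealRMK.rieszMeasure μ.variationLinear

/-- `μ.HasIntegral f c` says that `f` belongs to `L¹(|μ|)` and that `⟨μ, f⟩ = c`, where `⟨μ, ·⟩` is
extended by continuity from `C_c(X, ℂ)` to `L¹(|μ|)`: the number `c` is the limit of `μ g` as `g` in
`C_c(X, ℂ)` tends to `f` in the norm of `L¹(|μ|)`. -/
def HasIntegral (μ : ComplexRadonMeasure X) (f : X → ℂ) (c : ℂ) : Prop :=
  Integrable f μ.variation ∧
    Tendsto (fun g : C_c(X, ℂ) => μ g)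
      (comap (fun g : C_c(X, ℂ) => eLpNorm (fun x => g x - f x) 1 μ.variation) (𝓝 0)) (𝓝 c)

/-- `μ` is translation bounded: `sup_t |μ|(t + K) < ∞` for every compact set `K`. -/
def TranslationBounded [AddGroup X] (μ : ComplexRadonMeasure X) : Prop :=
  ∀ K : Set X, IsCompact K → ⨆ t : X, μ.variation ((fun x => t + x) '' K) < ∞

end Variation

section Reflection

variable {X : Type*} [TopologicalSpace X] [T2Space X] [AddGroup X] [IsTopologicalAddGroup X]

/-- The reflected function `f†(x) = f(-x)`. -/
def reflectFun (f : C_c(X, ℂ)) : C_c(X, ℂ) where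
  toFun x := f (-x)
  continuous_toFun := (map_continuous f).comp continuous_neg
  hasCompactSupport' := f.hasCompactSupport.comp_homeomorph (Homeomorph.neg X)

/-- The function `f~(x) = conj (f(-x))`. -/
def tildeFun (f : C_c(X, ℂ)) : C_c(X, ℂ) := star (reflectFun f)

/-- The reflected measure `μ†`, given by `⟨μ†, f⟩ = ⟨μ, f†⟩`. -/
def reflect (μ : ComplexRadonMeasure X) : ComplexRadonMeasure X where
  toFun f := μ (reflectFun f)
  map_add' f g := μ.toLinearMap.map_add (reflectFun f) (reflectFun g)
  map_smul' c f := μ.toLinearMap.map_smul c (reflectFun f)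
  bounded_on_compact K hK := by
    obtain ⟨C, hC⟩ := μ.bounded_on_compact (-K) hK.neg
    refine ⟨C, fun f hf B hB => hC (reflectFun f) ?_ B fun x => hB (-x)⟩
    refine closure_minimal ?_ hK.neg.isClosed
    intro x hx
    exact hf (subset_tsupport f hx)

end Reflection

section Fourier

/-- Euclidean space `ℝ^d`. It is identified with its dual group through the characters
`x ↦ exp (2 π i ⟨x, ξ⟩)`, for which Lebesgue measure is its own Plancherel measure. -/
abbrev Euc (d : ℕ) : Type := EuclideanSpace ℝ (Fin d)

variable {d : ℕ}

/-- The convolution `f * f~` of `f` in `C_c(ℝ^d)` with `f~`, with respect to Lebesgue measure. -/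
def selfConv (f : C_c(Euc d, ℂ)) : C_c(Euc d, ℂ) where
  toFun x := ∫ y, f y * tildeFun f (x - y)
  continuous_toFun :=
    (tildeFun f).hasCompactSupport.continuous_convolution_right (ContinuousLinearMap.mul ℝ ℂ)
      ((map_continuous f).locallyIntegrable) (map_continuous (tildeFun f))
  hasCompactSupport' :=
    HasCompactSupport.convolution (μ := volume) (ContinuousLinearMap.mul ℝ ℂ)
      f.hasCompactSupport (tildeFun f).hasCompactSupport

/-- `ν` is a Fourier transform of `μ`: for every `f` in `C_c(ℝ^d)` the inverse Fourier transform
`𝓕⁻ f` belongs to `L²(|ν|)` and `⟨μ, f * f~⟩ = ⟨ν, |𝓕⁻ f|²⟩`. -/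
def IsFourierTransform (μ ν : ComplexRadonMeasure (Euc d)) : Prop :=
  ∀ f : C_c(Euc d, ℂ),
    MemLp (𝓕⁻ (f : Euc d → ℂ)) 2 ν.variation ∧
      ν.HasIntegral (fun ξ => ((‖𝓕⁻ (f : Euc d → ℂ) ξ‖ ^ 2 : ℝ) : ℂ)) (μ (selfConv f))

/-- `μ` is transformable if it has a Fourier transform which is a measure. -/
def Transformable (μ : ComplexRadonMeasure (Euc d)) : Prop :=
  ∃ ν : ComplexRadonMeasure (Euc d), IsFourierTransform μ ν

/-- The space of translation bounded transformable measures on `ℝ^d`. -/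
def TransformableTB (d : ℕ) : Set (ComplexRadonMeasure (Euc d)) :=
  {μ | μ.Transformable ∧ μ.TranslationBounded}

end Fourier

end ComplexRadonMeasure

end

set_option linter.unusedSectionVars false

noncomputable section

/-! Write `ν` for a Fourier transform of `μ`. Polarization turns the defining identity into `⟨μ, f *
g~⟩ = ⟨ν, 𝓕⁻ f · conj (𝓕⁻ g)⟩` (`IsFourierTransform.hasIntegral_mul`). Letting `g` run through an
approximate identity gives `⟨μ, F⟩ = ⟨ν, 𝓕⁻ F⟩` whenever `𝓕⁻ F` is `|ν|`-integrable.

A Fourier transform is always translation bounded. By the closed graph theorem, `u ↦ 𝓕⁻ (χ u)` is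
bounded from bounded continuous functions to `L²(|ν|)`. For characters `u` of sup norm at most one,
the images are all the translates of `𝓕⁻ χ`, which is bounded away from zero near the origin;
Chebyshev's inequality then bounds `|ν|` on all translates of one neighbourhood of zero. Hence `|ν|`
integrates `(1 + ‖x‖)^(-(d+1))`, and dominated convergence gives the inversion formula `ν f = lim μ
(𝓕 f · a(·/(n+1)))` for a smooth cutoff `a` with `a 0 = 1`
(`IsFourierTransform.tendsto_apply_fourierCutoff`). Uniqueness of `ν` is immediate, and `ν g = ⟨μ, 𝓕
g⟩` as soon as `𝓕 g` is `|μ|`-integrable.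

If `μ` is translation bounded, then `𝓕⁻ f` lies in `L²(|μ|)` for every `f`
(`TranslationBounded.memLp_fourierInv`). The last formula with `g = f * f~` then says that `μ†` is a
Fourier transform of `ν`. Conversely, any Fourier transform `ρ` of `ν` equals `μ†`
(`IsFourierTransform.eq_reflect`); since `ρ` is translation bounded, so is `μ`. The bijection
follows because the transform squares to the involution `†`. -/

namespace ComplexRadonMeasure

open scoped BoundedContinuousFunction SchwartzMap

/-! ### Extension of `⟨μ, ·⟩` to `L¹(|μ|)` -/

section Integral

variable {X : Type*} [TopologicalSpace X] [T2Space X] [LocallyCompactSpace X] [NormalSpace X]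
  [MeasurableSpace X] [BorelSpace X]

instance regular_variation (μ : ComplexRadonMeasure X) : μ.variation.Regular :=
  NNRealRMK.rieszMeasure_regular _

lemma lintegral_variation (μ : ComplexRadonMeasure X) (f : C_c(X, ℝ≥0)) :
    ∫⁻ x, f x ∂μ.variation = μ.variationFun f :=
  NNRealRMK.lintegral_rieszMeasure _ f

lemma integrable_coe (μ : ComplexRadonMeasure X) (g : C_c(X, ℂ)) : Integrable g μ.variation :=
  (map_continuous g).integrable_of_hasCompactSupport g.hasCompactSupport

lemma enorm_apply_le (μ : ComplexRadonMeasure X) (g : C_c(X, ℂ)) :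
    ‖μ g‖ₑ ≤ ∫⁻ x, ‖g x‖ₑ ∂μ.variation := by
  let f : C_c(X, ℝ≥0) :=
    ⟨⟨fun x => ‖g x‖₊, (map_continuous g).nnnorm⟩, g.hasCompactSupport.comp_left nnnorm_zero⟩
  have h1 : ∫⁻ x, ‖g x‖ₑ ∂μ.variation = μ.variationFun f := μ.lintegral_variation f
  rw [h1]
  exact ENNReal.coe_le_coe.mpr (μ.le_variationFun fun x => le_rfl)

lemma norm_apply_le (μ : ComplexRadonMeasure X) (g : C_c(X, ℂ)) :
    ‖μ g‖ ≤ ∫ x, ‖g x‖ ∂μ.variation := by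
  have h := μ.enorm_apply_le g
  rw [← ofReal_integral_norm_eq_lintegral_enorm (μ.integrable_coe g), ← ofReal_norm] at h
  exact (ENNReal.ofReal_le_ofReal_iff (by positivity)).mp h

lemma norm_apply_sub_le (μ : ComplexRadonMeasure X) (g g' : C_c(X, ℂ)) :
    ‖μ g - μ g'‖ ≤ ∫ x, ‖g x - g' x‖ ∂μ.variation := by
  rw [← map_sub]
  exact μ.norm_apply_le (g - g')

lemma exists_integral_norm_sub_le (μ : ComplexRadonMeasure X) {f : X → ℂ}
    (hf : Integrable f μ.variation) {ε : ℝ} (hε : 0 < ε) :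
    ∃ g : C_c(X, ℂ), ∫ x, ‖g x - f x‖ ∂μ.variation ≤ ε := by
  obtain ⟨g, h1, h2, h3, -⟩ := hf.exists_hasCompactSupport_integral_sub_le hε
  refine ⟨⟨⟨g, h3⟩, h1⟩, ?_⟩
  exact (integral_congr_ae (.of_forall fun x => norm_sub_rev _ _)).trans_le h2

lemma integral_norm_sub_triangle (μ : ComplexRadonMeasure X) {f g h : X → ℂ}
    (hf : Integrable f μ.variation) (hg : Integrable g μ.variation)
    (hh : Integrable h μ.variation) :
    ∫ x, ‖f x - h x‖ ∂μ.variation ≤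
      ∫ x, ‖f x - g x‖ ∂μ.variation + ∫ x, ‖g x - h x‖ ∂μ.variation := by
  have h1 : Integrable (fun x => ‖f x - g x‖) μ.variation := (hf.sub hg).norm
  have h2 : Integrable (fun x => ‖g x - h x‖) μ.variation := (hg.sub hh).norm
  rw [← integral_add h1 h2]
  exact integral_mono (hf.sub hh).norm (h1.add h2)
    fun x => norm_sub_le_norm_sub_add_norm_sub _ _ _

lemma eLpNorm_one_sub_eq (μ : ComplexRadonMeasure X) {f : X → ℂ}
    (hf : Integrable f μ.variation) (g : C_c(X, ℂ)) :
    eLpNorm (fun x => g x - f x) 1 μ.variation =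
      ENNReal.ofReal (∫ x, ‖g x - f x‖ ∂μ.variation) := by
  rw [eLpNorm_one_eq_lintegral_enorm]
  exact (ofReal_integral_norm_eq_lintegral_enorm ((μ.integrable_coe g).sub hf)).symm

/-- The number `⟨μ, f⟩` is characterized by an explicit estimate. -/
lemma hasIntegral_iff (μ : ComplexRadonMeasure X) {f : X → ℂ} {c : ℂ} :
    μ.HasIntegral f c ↔ Integrable f μ.variation ∧
      ∀ g : C_c(X, ℂ), ‖μ g - c‖ ≤ ∫ x, ‖g x - f x‖ ∂μ.variation := by
  refine and_congr_right fun hf => ⟨fun h g => ?_, fun h => ?_⟩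
  · set l := comap (fun g : C_c(X, ℂ) => eLpNorm (fun x => g x - f x) 1 μ.variation) (𝓝 0)
    have hl : Tendsto (fun g : C_c(X, ℂ) => ∫ x, ‖g x - f x‖ ∂μ.variation) l (𝓝 0) := by
      have h1 := (ENNReal.tendsto_toReal ENNReal.zero_ne_top).comp
        (tendsto_comap (f := fun g : C_c(X, ℂ) => eLpNorm (fun x => g x - f x) 1 μ.variation)
          (x := 𝓝 0))
      refine h1.congr fun g => ?_
      simp only [Function.comp_apply]
      rw [μ.eLpNorm_one_sub_eq hf, ENNReal.toReal_ofReal (by positivity)]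
    -- Density of `C_c` in `L¹(|μ|)` makes the filter nontrivial, so estimates may be passed to the
    -- limit along it.
    have : l.NeBot := by
      rw [comap_neBot_iff]
      intro t ht
      obtain ⟨ε, hε, hεt⟩ := ENNReal.nhds_zero_basis.mem_iff.mp ht
      obtain ⟨r, hr0, hr⟩ := ENNReal.lt_iff_exists_real_btwn.mp hε
      have hr' : 0 < r := by
        rw [← ENNReal.ofReal_pos]; exact hr.1
      obtain ⟨g, hg⟩ := μ.exists_integral_norm_sub_le hf hr'
      refine ⟨g, hεt ?_⟩
      rw [Set.mem_Iio, μ.eLpNorm_one_sub_eq hf]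
      exact (ENNReal.ofReal_le_ofReal hg).trans_lt hr.2
    have h2 : Tendsto (fun g' : C_c(X, ℂ) => ‖μ g - μ g'‖) l (𝓝 ‖μ g - c‖) :=
      (h.const_sub (μ g)).norm
    have h3 := hl.const_add (∫ x, ‖g x - f x‖ ∂μ.variation)
    rw [add_zero] at h3
    refine le_of_tendsto_of_tendsto' h2 h3 fun g' => (μ.norm_apply_sub_le g g').trans ?_
    refine (μ.integral_norm_sub_triangle (μ.integrable_coe g) hf (μ.integrable_coe g')).trans ?_
    simp only [norm_sub_rev (f _), le_refl]
  · rw [tendsto_iff_norm_sub_tendsto_zero]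
    have h1 := (ENNReal.tendsto_toReal ENNReal.zero_ne_top).comp
      (tendsto_comap (f := fun g : C_c(X, ℂ) => eLpNorm (fun x => g x - f x) 1 μ.variation)
        (x := 𝓝 0))
    refine squeeze_zero (fun _ => norm_nonneg _) (fun g => ?_) h1
    simp only [Function.comp_apply]
    rw [μ.eLpNorm_one_sub_eq hf, ENNReal.toReal_ofReal (by positivity)]
    exact h g

variable {μ : ComplexRadonMeasure X}

lemma hasIntegral_coe (μ : ComplexRadonMeasure X) (g : C_c(X, ℂ)) : μ.HasIntegral g (μ g) :=
  μ.hasIntegral_iff.mpr ⟨μ.integrable_coe g, fun g' => μ.norm_apply_sub_le g' g⟩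

lemma HasIntegral.integrable {f : X → ℂ} {c : ℂ} (h : μ.HasIntegral f c) :
    Integrable f μ.variation := h.1

lemma HasIntegral.norm_sub_le {f f' : X → ℂ} {c c' : ℂ} (h : μ.HasIntegral f c)
    (h' : μ.HasIntegral f' c') : ‖c - c'‖ ≤ ∫ x, ‖f x - f' x‖ ∂μ.variation := by
  refine le_of_forall_pos_le_add fun ε hε => ?_
  obtain ⟨g, hg⟩ := μ.exists_integral_norm_sub_le h.1 (half_pos hε)
  have h1 := (μ.hasIntegral_iff.mp h).2 g
  have h2 := (μ.hasIntegral_iff.mp h').2 g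
  have h3 := μ.integral_norm_sub_triangle (μ.integrable_coe g) h.1 h'.1
  have h4 := norm_sub_le_norm_sub_add_norm_sub c (μ g) c'
  rw [norm_sub_rev c (μ g)] at h4
  linarith

lemma HasIntegral.unique {f : X → ℂ} {c c' : ℂ} (h : μ.HasIntegral f c)
    (h' : μ.HasIntegral f c') : c = c' := by
  have := h.norm_sub_le h'
  simpa [sub_eq_zero] using this

/-- Values of `μ` on `L¹`-approximants of `f` form a Cauchy sequence, because `μ` is 1-Lipschitz for
the `L¹(|μ|)` norm; the limit inherits the estimate of `hasIntegral_iff`. -/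
lemma exists_hasIntegral (μ : ComplexRadonMeasure X) {f : X → ℂ} (hf : Integrable f μ.variation) :
    ∃ c, μ.HasIntegral f c := by
  choose g hg using fun n : ℕ =>
    μ.exists_integral_norm_sub_le hf (Nat.one_div_pos_of_nat (α := ℝ) (n := n))
  have key : ∀ (n : ℕ) (g' : C_c(X, ℂ)),
      ‖μ g' - μ (g n)‖ ≤ ∫ x, ‖g' x - f x‖ ∂μ.variation + 1 / ((n : ℝ) + 1) := by
    intro n g'
    refine (μ.norm_apply_sub_le _ _).trans ((μ.integral_norm_sub_triangle
      (μ.integrable_coe g') hf (μ.integrable_coe (g n))).trans ?_)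
    gcongr
    simpa only [norm_sub_rev] using hg n
  have hlim := tendsto_one_div_add_atTop_nhds_zero_nat (𝕜 := ℝ)
  have hc : CauchySeq fun n => μ (g n) := by
    refine cauchySeq_of_le_tendsto_0' (fun n : ℕ => 1 / ((n : ℝ) + 1) + 1 / ((n : ℝ) + 1))
      (fun n m hnm => ?_) (by simpa using hlim.add hlim)
    rw [dist_eq_norm]
    refine (key m (g n)).trans (add_le_add (hg n) ?_)
    exact Nat.one_div_le_one_div hnm
  obtain ⟨c, hc⟩ := cauchySeq_tendsto_of_complete hc
  refine ⟨c, μ.hasIntegral_iff.mpr ⟨hf, fun g' => ?_⟩⟩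
  have h1 := hlim.const_add (∫ x, ‖g' x - f x‖ ∂μ.variation)
  rw [add_zero] at h1
  exact le_of_tendsto_of_tendsto' (hc.const_sub (μ g')).norm h1 fun n => key n g'

lemma HasIntegral.add {f f' : X → ℂ} {c c' : ℂ} (h : μ.HasIntegral f c)
    (h' : μ.HasIntegral f' c') : μ.HasIntegral (fun x => f x + f' x) (c + c') := by
  refine μ.hasIntegral_iff.mpr ⟨h.1.add h'.1, fun g => le_of_forall_pos_le_add fun ε hε => ?_⟩
  -- Splitting off an approximant `g'` of `f'` leaves `g - g'` to be compared with `f`, at a total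
  -- cost of twice the error of `g'`.
  obtain ⟨g', hg'⟩ := μ.exists_integral_norm_sub_le h'.1 (half_pos hε)
  have h1 := (μ.hasIntegral_iff.mp h).2 (g - g')
  have h2 := (μ.hasIntegral_iff.mp h').2 g'
  have h3 : ∫ x, ‖(g - g') x - f x‖ ∂μ.variation ≤
      ∫ x, ‖g x - (f x + f' x)‖ ∂μ.variation + ∫ x, ‖g' x - f' x‖ ∂μ.variation := by
    have i1 : Integrable (fun x => g x - (f x + f' x)) μ.variation :=
      (μ.integrable_coe g).sub (h.1.add h'.1)
    have i2 : Integrable (fun x => g' x - f' x) μ.variation := (μ.integrable_coe g').sub h'.1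
    rw [← integral_add i1.norm i2.norm]
    refine integral_mono ((μ.integrable_coe (g - g')).sub h.1).norm (i1.norm.add i2.norm)
      fun x => ?_
    refine le_trans (le_of_eq ?_) (_root_.norm_sub_le _ _)
    rw [CompactlySupportedContinuousMap.sub_apply]
    congr 1
    ring
  have h4 : ‖μ g - (c + c')‖ ≤ ‖μ (g - g') - c‖ + ‖μ g' - c'‖ := by
    refine le_trans (le_of_eq ?_) (norm_add_le _ _)
    rw [map_sub]
    congr 1
    ring
  linarith

lemma HasIntegral.const_mul {f : X → ℂ} {c : ℂ} (h : μ.HasIntegral f c) (a : ℂ) :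
    μ.HasIntegral (fun x => a * f x) (a * c) := by
  by_cases ha : a = 0
  · subst ha
    simp only [zero_mul]
    simpa using! μ.hasIntegral_coe 0
  refine μ.hasIntegral_iff.mpr ⟨h.1.const_mul a, fun g => ?_⟩
  have h1 := (μ.hasIntegral_iff.mp h).2 (a⁻¹ • g)
  have h2 : ‖μ g - a * c‖ = ‖a‖ * ‖μ (a⁻¹ • g) - c‖ := by
    rw [← norm_mul, map_smul, smul_eq_mul, mul_sub, mul_inv_cancel_left₀ ha]
  have h3 : ∫ x, ‖g x - a * f x‖ ∂μ.variation =
      ‖a‖ * ∫ x, ‖(a⁻¹ • g) x - f x‖ ∂μ.variation := by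
    rw [← integral_const_mul]
    congr 1 with x
    rw [← norm_mul, CompactlySupportedContinuousMap.smul_apply, smul_eq_mul, mul_sub,
      mul_inv_cancel_left₀ ha]
  rw [h2, h3]
  gcongr

/-- Dominated convergence for `⟨μ, ·⟩`. -/
lemma HasIntegral.tendsto_of_dominated {F : ℕ → X → ℂ} {c : ℕ → ℂ} {f : X → ℂ} {c₀ : ℂ}
    (hF : ∀ n, μ.HasIntegral (F n) (c n)) (hf : μ.HasIntegral f c₀) (bound : X → ℝ)
    (hb : Integrable bound μ.variation) (hle : ∀ n x, ‖F n x‖ ≤ bound x)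
    (hlim : ∀ x, Tendsto (fun n => F n x) atTop (𝓝 (f x))) : Tendsto c atTop (𝓝 c₀) := by
  rw [tendsto_iff_norm_sub_tendsto_zero]
  refine squeeze_zero (fun _ => norm_nonneg _) (fun n => (hF n).norm_sub_le hf) ?_
  have h0 : ∫ x, ‖f x - f x‖ ∂μ.variation = 0 := by simp
  rw [← h0]
  refine tendsto_integral_of_dominated_convergence (fun x => bound x + ‖f x‖)
    (fun n => ((hF n).1.sub hf.1).norm.aestronglyMeasurable) (hb.add hf.1.norm) (fun n => ?_) ?_
  · refine Eventually.of_forall fun x => ?_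
    rw [norm_norm]
    exact (_root_.norm_sub_le _ _).trans (add_le_add_left (hle n x) _)
  · exact Eventually.of_forall fun x => ((hlim x).sub_const _).norm

end Integral

/-! ### Reflection of functions and measures -/

section Reflection

variable {X : Type*} [TopologicalSpace X] [T2Space X] [AddCommGroup X] [IsTopologicalAddGroup X]

@[simp] lemma reflectFun_apply (f : C_c(X, ℂ)) (x : X) : reflectFun f x = f (-x) := rfl

@[simp] lemma tildeFun_apply (f : C_c(X, ℂ)) (x : X) : tildeFun f x = star (f (-x)) := rfl

@[simp] lemma reflectFun_reflectFun (f : C_c(X, ℂ)) : reflectFun (reflectFun f) = f := by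
  ext x; simp

lemma reflect_apply (μ : ComplexRadonMeasure X) (f : C_c(X, ℂ)) :
    μ.reflect f = μ (reflectFun f) := rfl

lemma ext_apply {Y : Type*} [TopologicalSpace Y] {μ ν : ComplexRadonMeasure Y}
    (h : ∀ f : C_c(Y, ℂ), μ f = ν f) : μ = ν := by
  cases μ; cases ν
  congr
  exact LinearMap.ext h

@[simp] lemma reflect_reflect (μ : ComplexRadonMeasure X) : μ.reflect.reflect = μ :=
  ext_apply fun f => by rw [reflect_apply, reflect_apply, reflectFun_reflectFun]

variable [LocallyCompactSpace X] [NormalSpace X] [MeasurableSpace X] [BorelSpace X]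

/-- Both sides are regular, so testing on nonnegative functions in `C_c` suffices; there `g ↦ g†`
matches the competitors in the two suprema. -/
lemma variation_reflect (μ : ComplexRadonMeasure X) :
    μ.reflect.variation = μ.variation.map (Homeomorph.neg X) := by
  have : (μ.variation.map (Homeomorph.neg X)).Regular := Measure.Regular.map _
  refine Measure.ext_of_integral_eq_on_compactlySupported_nnreal fun f => ?_
  have hm : MeasurableEmbedding (Homeomorph.neg X) := (Homeomorph.neg X).measurableEmbedding
  let f' : C_c(X, ℝ≥0) := ⟨⟨fun x => f (-x), (map_continuous f).comp continuous_neg⟩,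
    f.hasCompactSupport.comp_homeomorph (Homeomorph.neg X)⟩
  have h1 : ∫ x, (f x : ℝ) ∂μ.reflect.variation = μ.reflect.variationFun f :=
    NNRealRMK.integral_rieszMeasure _ f
  have h2 : ∫ x, (f' x : ℝ) ∂μ.variation = μ.variationFun f' :=
    NNRealRMK.integral_rieszMeasure _ f'
  rw [h1, hm.integral_map]
  refine Eq.trans ?_ h2.symm
  congr 1
  refine le_antisymm (variationFun_le _ fun g hg => ?_) (variationFun_le _ fun g hg => ?_)
  · exact μ.le_variationFun fun x => hg (-x)
  · rw [← reflectFun_reflectFun g, ← reflect_apply]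
    refine μ.reflect.le_variationFun fun x => ?_
    have := hg (-x)
    change ‖g (-x)‖₊ ≤ f (- -x) at this
    rwa [neg_neg] at this

lemma HasIntegral.reflect {μ : ComplexRadonMeasure X} {f : X → ℂ} {c : ℂ}
    (h : μ.HasIntegral f c) : μ.reflect.HasIntegral (fun x => f (-x)) c := by
  have hm : MeasurableEmbedding (Homeomorph.neg X) := (Homeomorph.neg X).measurableEmbedding
  rw [hasIntegral_iff] at h ⊢
  rw [variation_reflect, hm.integrable_map_iff]
  refine ⟨?_, fun g => ?_⟩
  · convert h.1 using 1
    ext x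
    simp
  · rw [hm.integral_map]
    rw [reflect_apply]
    simpa using h.2 (reflectFun g)

lemma TranslationBounded.reflect {μ : ComplexRadonMeasure X} (h : μ.TranslationBounded) :
    μ.reflect.TranslationBounded := by
  intro K hK
  refine lt_of_le_of_lt (iSup_le fun t => ?_) (h (-K) hK.neg)
  have hm : MeasurableEmbedding (Homeomorph.neg X) := (Homeomorph.neg X).measurableEmbedding
  rw [variation_reflect, hm.map_apply]
  refine le_trans (measure_mono ?_)
    (le_iSup (fun t => μ.variation ((fun x => t + x) '' (-K))) (-t))
  rintro x ⟨k, hk, hx⟩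
  refine ⟨-k, by simpa using hk, ?_⟩
  change t + k = -x at hx
  rw [← neg_neg x, ← hx]
  abel_nf

end Reflection

/-! ### Convolution and polarization -/

variable {d : ℕ}

lemma integrable_volume_coe (f : C_c(Euc d, ℂ)) : Integrable (f : Euc d → ℂ) :=
  (map_continuous f).integrable_of_hasCompactSupport f.hasCompactSupport

/-- The convolution of two functions in `C_c(ℝ^d)`. -/
def conv (f g : C_c(Euc d, ℂ)) : C_c(Euc d, ℂ) where
  toFun x := ∫ y, f y * g (x - y)
  continuous_toFun :=
    g.hasCompactSupport.continuous_convolution_right (ContinuousLinearMap.mul ℝ ℂ)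
      ((map_continuous f).locallyIntegrable) (map_continuous g)
  hasCompactSupport' :=
    HasCompactSupport.convolution (μ := volume) (ContinuousLinearMap.mul ℝ ℂ)
      f.hasCompactSupport g.hasCompactSupport

lemma conv_apply (f g : C_c(Euc d, ℂ)) (x : Euc d) : conv f g x = ∫ y, f y * g (x - y) := rfl

lemma selfConv_eq_conv (f : C_c(Euc d, ℂ)) : selfConv f = conv f (tildeFun f) := rfl

lemma integrable_conv_integrand (f g : C_c(Euc d, ℂ)) (x : Euc d) :
    Integrable fun y => f y * g (x - y) := by
  refine Continuous.integrable_of_hasCompactSupport ?_ f.hasCompactSupport.mul_right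
  exact (map_continuous f).mul ((map_continuous g).comp (continuous_const.sub continuous_id))

lemma selfConv_add_smul (f g : C_c(Euc d, ℂ)) (a : ℂ) :
    selfConv (f + a • g) = selfConv f + star a • conv f (tildeFun g) +
      a • conv g (tildeFun f) + (a * star a) • selfConv g := by
  ext x
  simp only [selfConv_eq_conv, CompactlySupportedContinuousMap.add_apply,
    CompactlySupportedContinuousMap.smul_apply, smul_eq_mul, conv_apply]
  rw [← integral_const_mul, ← integral_const_mul, ← integral_const_mul, ← integral_add,
    ← integral_add, ← integral_add]
  · congr 1 with y
    simp only [tildeFun_apply, CompactlySupportedContinuousMap.add_apply,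
      CompactlySupportedContinuousMap.smul_apply, smul_eq_mul, star_add, star_mul']
    ring
  · exact ((integrable_conv_integrand _ _ _).add
      ((integrable_conv_integrand _ _ _).const_mul _)).add
      ((integrable_conv_integrand _ _ _).const_mul _)
  · exact (integrable_conv_integrand _ _ _).const_mul _
  · exact (integrable_conv_integrand _ _ _).add ((integrable_conv_integrand _ _ _).const_mul _)
  · exact (integrable_conv_integrand _ _ _).const_mul _
  · exact integrable_conv_integrand _ _ _
  · exact (integrable_conv_integrand _ _ _).const_mul _

/-- In the sum over `a ∈ {1, -1, I, -I}` of `a • selfConv (f + a • g)`, the sums of `a` and of `a²`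
vanish while `a * star a = 1`, so only four copies of `f * g~` survive. -/
lemma polarization (f g : C_c(Euc d, ℂ)) :
    conv f (tildeFun g) = (1 / 4 : ℂ) • (selfConv (f + (1 : ℂ) • g) +
      (-1 : ℂ) • selfConv (f + (-1 : ℂ) • g) + Complex.I • selfConv (f + Complex.I • g) +
      (-Complex.I) • selfConv (f + (-Complex.I) • g)) := by
  simp only [selfConv_add_smul]
  ext x
  simp only [CompactlySupportedContinuousMap.add_apply,
    CompactlySupportedContinuousMap.smul_apply, smul_eq_mul, RCLike.star_def, map_neg, map_one,
    Complex.conj_I]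
  linear_combination (1/2 * conv f (tildeFun g) x - 1/2 * conv g (tildeFun f) x)
    * Complex.I_sq

lemma integrable_fourierInv_integrand {f : Euc d → ℂ} (hf : Integrable f) (ξ : Euc d) :
    Integrable fun v => 𝐞 (inner ℝ v ξ) • f v := by
  have := (Real.fourierIntegral_convergent_iff (f := f) (μ := volume) (-ξ)).mpr hf
  simpa using this

lemma fourierInv_add_smul (f g : C_c(Euc d, ℂ)) (a : ℂ) (ξ : Euc d) :
    𝓕⁻ ((f + a • g : C_c(Euc d, ℂ)) : Euc d → ℂ) ξ =
      𝓕⁻ (f : Euc d → ℂ) ξ + a * 𝓕⁻ (g : Euc d → ℂ) ξ := by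
  simp only [Real.fourierInv_eq]
  rw [← integral_const_mul, ← integral_add]
  · congr 1 with y
    simp only [CompactlySupportedContinuousMap.add_apply,
      CompactlySupportedContinuousMap.smul_apply, smul_eq_mul, Circle.smul_def]
    ring
  · exact integrable_fourierInv_integrand (integrable_volume_coe f) ξ
  · exact (integrable_fourierInv_integrand (integrable_volume_coe g) ξ).const_mul a

lemma continuous_fourierInv {f : Euc d → ℂ} (hf : Integrable f) : Continuous (𝓕⁻ f) := by
  have h := VectorFourier.fourierIntegral_continuous Real.continuous_fourierChar
    (L := innerₗ (Euc d)) (μ := volume) (by exact continuous_inner) hf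
  have h2 : 𝓕⁻ f = fun w => 𝓕 f (-w) := by
    ext w; exact Real.fourierInv_eq_fourier_neg f w
  rw [h2]
  exact h.comp continuous_neg

/-- The polarized form of the identity that defines the Fourier transform. -/
lemma IsFourierTransform.hasIntegral_mul {μ ν : ComplexRadonMeasure (Euc d)}
    (h : μ.IsFourierTransform ν) (f g : C_c(Euc d, ℂ)) :
    ν.HasIntegral (fun ξ => 𝓕⁻ (f : Euc d → ℂ) ξ * star (𝓕⁻ (g : Euc d → ℂ) ξ))
      (μ (conv f (tildeFun g))) := by
  rw [polarization, map_smul, map_add, map_add, map_add, map_smul, map_smul, map_smul]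
  have key := (((((h (f + (1 : ℂ) • g)).2.add ((h (f + (-1 : ℂ) • g)).2.const_mul (-1))).add
    ((h (f + Complex.I • g)).2.const_mul Complex.I)).add
    ((h (f + (-Complex.I) • g)).2.const_mul (-Complex.I))).const_mul (1 / 4))
  refine Eq.subst (motive := fun F => ν.HasIntegral F _) ?_ key
  ext ξ
  simp only [fourierInv_add_smul, ← Complex.normSq_eq_norm_sq, ← Complex.mul_conj, map_add,
    map_mul, map_neg, map_one, Complex.conj_I, RCLike.star_def]
  set p := 𝓕⁻ (f : Euc d → ℂ) ξ
  set q := 𝓕⁻ (g : Euc d → ℂ) ξ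
  linear_combination (-1/2 * p * (starRingEnd ℂ) q + 1/2 * q * (starRingEnd ℂ) p)
    * Complex.I_sq

lemma tendsto_of_tendstoUniformly (μ : ComplexRadonMeasure (Euc d)) {G : ℕ → C_c(Euc d, ℂ)}
    {F : C_c(Euc d, ℂ)} {K : Set (Euc d)} (hK : IsCompact K) (hG : ∀ n, ∀ x ∉ K, G n x = F x)
    (h : TendstoUniformly (fun n x => G n x) F atTop) :
    Tendsto (fun n => μ (G n)) atTop (𝓝 (μ F)) := by
  obtain ⟨C, hC⟩ := μ.bounded_on_compact K hK
  rw [Metric.tendsto_nhds]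
  intro ε hε
  have hδ : 0 < ε / (C + 1) := by positivity
  filter_upwards [Metric.tendstoUniformly_iff.mp h _ hδ] with n hn
  have h1 : ‖μ (G n - F)‖₊ ≤ C * (ε / (C + 1)).toNNReal := by
    refine hC (G n - F) (closure_minimal (fun x hx => ?_) hK.isClosed) _ fun x => ?_
    · by_contra hxK
      exact hx (by simp [hG n x hxK])
    · rw [← NNReal.coe_le_coe, Real.coe_toNNReal _ hδ.le, coe_nnnorm]
      have := hn x
      rw [dist_comm, dist_eq_norm] at this
      exact this.le
  rw [dist_eq_norm, ← map_sub]
  rw [← NNReal.coe_le_coe, NNReal.coe_mul, Real.coe_toNNReal _ hδ.le, coe_nnnorm] at h1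
  refine h1.trans_lt ?_
  rw [← mul_div_assoc, div_lt_iff₀ (by positivity)]
  nlinarith [C.coe_nonneg]

/-! ### Approximate identities -/

/-- A smooth bump function with support in the ball of radius `1 / (n + 1)`. -/
def bump (d n : ℕ) : ContDiffBump (0 : Euc d) where
  rIn := 1 / (2 * ((n : ℝ) + 1))
  rOut := 1 / ((n : ℝ) + 1)
  rIn_pos := by positivity
  rIn_lt_rOut := by
    apply one_div_lt_one_div_of_lt <;> nlinarith [(Nat.cast_nonneg n : (0 : ℝ) ≤ n)]

/-- A nonnegative approximate identity in `C_c(ℝ^d)`. -/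
def mollifier (d n : ℕ) : C_c(Euc d, ℂ) where
  toFun x := (((bump d n).normed volume x : ℝ) : ℂ)
  continuous_toFun := Complex.continuous_ofReal.comp (bump d n).continuous_normed
  hasCompactSupport' := (bump d n).hasCompactSupport_normed.comp_left Complex.ofReal_zero

lemma mollifier_apply (n : ℕ) (x : Euc d) :
    mollifier d n x = (((bump d n).normed volume x : ℝ) : ℂ) := rfl

lemma mollifier_eq_zero {n : ℕ} {x : Euc d} (hx : 1 / ((n : ℝ) + 1) ≤ ‖x‖) :
    mollifier d n x = 0 := by
  rw [mollifier_apply, Complex.ofReal_eq_zero, ← Function.notMem_support,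
    (bump d n).support_normed_eq]
  simpa [bump] using hx

lemma norm_mollifier (n : ℕ) (x : Euc d) :
    ‖mollifier d n x‖ = (bump d n).normed volume x := by
  rw [mollifier_apply, Complex.norm_real, Real.norm_of_nonneg ((bump d n).nonneg_normed x)]

lemma norm_integral_mollifier_mul_le {n : ℕ} {g : Euc d → ℂ} {B : ℝ}
    (h : ∀ y, ‖y‖ < 1 / ((n : ℝ) + 1) → ‖g y‖ ≤ B) : ‖∫ y, mollifier d n y * g y‖ ≤ B := by
  calc ‖∫ y, mollifier d n y * g y‖ ≤ ∫ y, (bump d n).normed volume y * B := by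
        refine norm_integral_le_of_norm_le ((bump d n).integrable_normed.mul_const B)
          (.of_forall fun y => ?_)
        by_cases hy : ‖y‖ < 1 / ((n : ℝ) + 1)
        · rw [norm_mul, norm_mollifier]
          exact mul_le_mul_of_nonneg_left (h y hy) ((bump d n).nonneg_normed y)
        · have h1 := mollifier_eq_zero (not_lt.mp hy)
          rw [norm_mul, ← norm_mollifier, h1]
          simp
    _ = B := by rw [integral_mul_const, (bump d n).integral_normed, one_mul]

lemma norm_integral_mollifier_mul_sub_le {n : ℕ} {g : Euc d → ℂ} (hg : Continuous g) {c : ℂ}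
    {ε : ℝ} (h : ∀ y, ‖y‖ < 1 / ((n : ℝ) + 1) → ‖g y - c‖ ≤ ε) :
    ‖(∫ y, mollifier d n y * g y) - c‖ ≤ ε := by
  have h1 : ∫ y, mollifier d n y * c = c := by
    rw [integral_mul_const]
    simp only [mollifier_apply]
    rw [integral_complex_ofReal, (bump d n).integral_normed]
    simp
  have h2 : (∫ y, mollifier d n y * g y) - c = ∫ y, mollifier d n y * (g y - c) := by
    simp_rw [mul_sub]
    rw [integral_sub _ ((integrable_volume_coe _).mul_const c), h1]
    exact ((map_continuous _).mul hg).integrable_of_hasCompactSupport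
      (mollifier d n).hasCompactSupport.mul_right
  rw [h2]
  exact norm_integral_mollifier_mul_le h

lemma conv_tildeFun_mollifier_apply (F : C_c(Euc d, ℂ)) (n : ℕ) (x : Euc d) :
    conv F (tildeFun (mollifier d n)) x = ∫ y, mollifier d n y * F (x + y) := by
  rw [conv_apply, ← integral_add_left_eq_self _ x]
  congr 1 with y
  rw [tildeFun_apply, mul_comm]
  simp [mollifier_apply]

lemma tendstoUniformly_conv_mollifier (F : C_c(Euc d, ℂ)) :
    TendstoUniformly (fun n x => conv F (tildeFun (mollifier d n)) x) F atTop := by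
  rw [Metric.tendstoUniformly_iff]
  intro ε hε
  obtain ⟨δ, hδ, h⟩ := Metric.uniformContinuous_iff.mp
    (CompactlySupportedContinuousMapClass.uniformContinuous F) (ε / 2) (half_pos hε)
  filter_upwards [(tendsto_order.mp tendsto_one_div_add_atTop_nhds_zero_nat).2 δ hδ] with n hn x
  rw [dist_comm, dist_eq_norm, conv_tildeFun_mollifier_apply]
  refine (norm_integral_mollifier_mul_sub_le (by fun_prop) fun y hy => ?_).trans_lt
    (half_lt_self hε)
  rw [← dist_eq_norm]
  refine (h ?_).le
  simpa using hy.trans hn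

lemma conv_mollifier_eq_zero {F : C_c(Euc d, ℂ)} {x : Euc d}
    (hx : x ∉ Metric.cthickening 1 (tsupport F)) (n : ℕ) :
    conv F (tildeFun (mollifier d n)) x = 0 := by
  rw [conv_tildeFun_mollifier_apply]
  refine integral_eq_zero_of_ae (.of_forall fun y => ?_)
  by_cases hy : ‖y‖ < 1 / ((n : ℝ) + 1)
  · have : F (x + y) = 0 := by
      by_contra h0
      refine hx (Metric.mem_cthickening_of_dist_le x (x + y) 1 _
        (subset_tsupport _ h0) ?_)
      have h1 : 1 / ((n : ℝ) + 1) ≤ 1 := by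
        rw [div_le_one (by positivity)]; linarith [(Nat.cast_nonneg n : (0 : ℝ) ≤ n)]
      simpa using hy.le.trans h1
    simp [this]
  · simp [mollifier_eq_zero (not_lt.mp hy)]

lemma tendsto_apply_conv_mollifier (μ : ComplexRadonMeasure (Euc d)) (F : C_c(Euc d, ℂ)) :
    Tendsto (fun n => μ (conv F (tildeFun (mollifier d n)))) atTop (𝓝 (μ F)) := by
  refine μ.tendsto_of_tendstoUniformly (K := Metric.cthickening 1 (tsupport F))
    F.hasCompactSupport.isCompact.cthickening (fun n x hx => ?_)
    (tendstoUniformly_conv_mollifier F)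
  rw [conv_mollifier_eq_zero hx]
  by_contra h0
  exact hx (Metric.self_subset_cthickening _ (subset_tsupport _ (Ne.symm h0)))

lemma fourierInv_mollifier (n : ℕ) (ξ : Euc d) :
    𝓕⁻ (mollifier d n : Euc d → ℂ) ξ = ∫ y, mollifier d n y * (𝐞 (inner ℝ y ξ) : ℂ) := by
  rw [Real.fourierInv_eq]
  congr 1 with y
  rw [Circle.smul_def, smul_eq_mul, mul_comm]

lemma norm_fourierInv_mollifier_le (n : ℕ) (ξ : Euc d) :
    ‖𝓕⁻ (mollifier d n : Euc d → ℂ) ξ‖ ≤ 1 := by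
  rw [fourierInv_mollifier]
  exact norm_integral_mollifier_mul_le fun y _ => (Circle.norm_coe _).le

lemma tendsto_fourierInv_mollifier (ξ : Euc d) :
    Tendsto (fun n => 𝓕⁻ (mollifier d n : Euc d → ℂ) ξ) atTop (𝓝 1) := by
  have hc : Continuous fun y : Euc d => (𝐞 (inner ℝ y ξ) : ℂ) :=
    continuous_subtype_val.comp (Real.continuous_fourierChar.comp (by fun_prop))
  rw [Metric.tendsto_nhds]
  intro ε hε
  obtain ⟨δ, hδ, h⟩ := Metric.continuousAt_iff.mp (hc.continuousAt (x := 0)) (ε / 2) (half_pos hε)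
  filter_upwards [(tendsto_order.mp tendsto_one_div_add_atTop_nhds_zero_nat).2 δ hδ] with n hn
  rw [dist_eq_norm, fourierInv_mollifier]
  refine (norm_integral_mollifier_mul_sub_le hc fun y hy => ?_).trans_lt
    (half_lt_self hε)
  have h1 := h (x := y) (by simpa using hy.trans hn)
  rw [dist_eq_norm] at h1
  simpa using h1.le

/-- The identity `⟨μ, F⟩ = ⟨ν, 𝓕⁻ F⟩` for `F` with `ν`-integrable transform. -/
lemma IsFourierTransform.hasIntegral_fourierInv {μ ν : ComplexRadonMeasure (Euc d)}
    (h : μ.IsFourierTransform ν) (F : C_c(Euc d, ℂ))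
    (hF : Integrable (𝓕⁻ (F : Euc d → ℂ)) ν.variation) :
    ν.HasIntegral (𝓕⁻ (F : Euc d → ℂ)) (μ F) := by
  obtain ⟨c, hc⟩ := ν.exists_hasIntegral hF
  -- On the side of `ν` the extra factor is the conjugate transform of the mollifier, of modulus at
  -- most one and tending to one. On the side of `μ` the convolutions converge uniformly within a
  -- fixed compact set.
  have h1 := HasIntegral.tendsto_of_dominated (fun n => h.hasIntegral_mul F (mollifier d n)) hc
    (fun ξ => ‖𝓕⁻ (F : Euc d → ℂ) ξ‖) hF.norm (fun n ξ => ?_) (fun ξ => ?_)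
  · rwa [tendsto_nhds_unique (μ.tendsto_apply_conv_mollifier F) h1]
  · rw [norm_mul, norm_star]
    exact mul_le_of_le_one_right (norm_nonneg _) (norm_fourierInv_mollifier_le n ξ)
  · simpa using (tendsto_fourierInv_mollifier ξ).star.const_mul (𝓕⁻ (F : Euc d → ℂ) ξ)

/-! ### Fourier transforms are translation bounded -/

/-- The product of a function in `C_c(ℝ^d)` and a bounded continuous function. -/
def mulBCF (χ : C_c(Euc d, ℂ)) (u : Euc d →ᵇ ℂ) : C_c(Euc d, ℂ) where
  toFun x := χ x * u x
  continuous_toFun := (map_continuous χ).mul u.continuous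
  hasCompactSupport' := χ.hasCompactSupport.mul_right

lemma mulBCF_apply (χ : C_c(Euc d, ℂ)) (u : Euc d →ᵇ ℂ) (x : Euc d) :
    mulBCF χ u x = χ x * u x := rfl

lemma mulBCF_add_smul (χ : C_c(Euc d, ℂ)) (u v : Euc d →ᵇ ℂ) (a : ℂ) :
    mulBCF χ (u + a • v) = mulBCF χ u + a • mulBCF χ v := by
  ext x
  simp [mulBCF_apply]
  ring

lemma norm_fourierInv_mulBCF_le (χ : C_c(Euc d, ℂ)) (u : Euc d →ᵇ ℂ) (ξ : Euc d) :
    ‖𝓕⁻ (mulBCF χ u : Euc d → ℂ) ξ‖ ≤ (∫ x, ‖χ x‖) * ‖u‖ := by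
  rw [Real.fourierInv_eq, ← integral_mul_const]
  refine norm_integral_le_of_norm_le ((integrable_volume_coe χ).norm.mul_const _)
    (.of_forall fun x => ?_)
  rw [Circle.norm_smul, mulBCF_apply, norm_mul]
  exact mul_le_mul_of_nonneg_left (u.norm_coe_le_norm x) (norm_nonneg _)

lemma tendsto_fourierInv_mulBCF (χ : C_c(Euc d, ℂ)) {u : ℕ → Euc d →ᵇ ℂ} {v : Euc d →ᵇ ℂ}
    (h : Tendsto u atTop (𝓝 v)) (ξ : Euc d) :
    Tendsto (fun n => 𝓕⁻ (mulBCF χ (u n) : Euc d → ℂ) ξ) atTop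
      (𝓝 (𝓕⁻ (mulBCF χ v : Euc d → ℂ) ξ)) := by
  rw [tendsto_iff_norm_sub_tendsto_zero] at h ⊢
  have h1 := h.const_mul (∫ x, ‖χ x‖)
  rw [mul_zero] at h1
  refine squeeze_zero (fun _ => norm_nonneg _) (fun n => ?_) h1
  refine le_trans (le_of_eq ?_) (norm_fourierInv_mulBCF_le χ (u n - v) ξ)
  have h2 : u n - v = u n + (-1 : ℂ) • v := by rw [neg_one_smul, sub_eq_add_neg]
  rw [h2, mulBCF_add_smul, fourierInv_add_smul]
  congr 1
  ring

/-- Multiplication by `χ` followed by the Fourier transform, as a map to `L²`. -/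
def transformL2 {m : Measure (Euc d)}
    (h : ∀ f : C_c(Euc d, ℂ), MemLp (𝓕⁻ (f : Euc d → ℂ)) 2 m) (χ : C_c(Euc d, ℂ)) :
    (Euc d →ᵇ ℂ) →ₗ[ℂ] Lp ℂ 2 m where
  toFun u := (h (mulBCF χ u)).toLp
  map_add' u v := by
    rw [← MemLp.toLp_add]
    congr 1
    ext ξ
    have := fourierInv_add_smul (mulBCF χ u) (mulBCF χ v) 1 ξ
    rw [← mulBCF_add_smul, one_smul, one_mul] at this
    exact this
  map_smul' a u := by
    rw [RingHom.id_apply, ← MemLp.toLp_const_smul]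
    congr 1
    ext ξ
    have := fourierInv_add_smul (mulBCF χ 0) (mulBCF χ u) a ξ
    rw [← mulBCF_add_smul, zero_add] at this
    have h0 : 𝓕⁻ (mulBCF χ 0 : Euc d → ℂ) ξ = 0 := by
      simpa using norm_fourierInv_mulBCF_le χ 0 ξ
    rw [h0, zero_add] at this
    exact this

lemma coeFn_transformL2 {m : Measure (Euc d)}
    (h : ∀ f : C_c(Euc d, ℂ), MemLp (𝓕⁻ (f : Euc d → ℂ)) 2 m) (χ : C_c(Euc d, ℂ))
    (u : Euc d →ᵇ ℂ) : transformL2 h χ u =ᵐ[m] 𝓕⁻ (mulBCF χ u : Euc d → ℂ) :=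
  (h (mulBCF χ u)).coeFn_toLp

/-- Closed graph theorem: an `L²` limit is an a.e. limit along a subsequence, while uniform
convergence of `u n` already forces pointwise convergence of the transforms, so the two limits
agree. -/
lemma continuous_transformL2 {m : Measure (Euc d)}
    (h : ∀ f : C_c(Euc d, ℂ), MemLp (𝓕⁻ (f : Euc d → ℂ)) 2 m) (χ : C_c(Euc d, ℂ)) :
    Continuous (transformL2 h χ) := by
  refine LinearMap.continuous_of_seq_closed_graph _ fun u v y hu hy => ?_
  obtain ⟨ns, hns, hae⟩ := (tendstoInMeasure_of_tendsto_Lp hy).exists_seq_tendsto_ae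
  refine Lp.ext ?_
  have hall : ∀ᵐ x ∂m, ∀ n, transformL2 h χ (u n) x = 𝓕⁻ (mulBCF χ (u n) : Euc d → ℂ) x :=
    ae_all_iff.mpr fun n => coeFn_transformL2 h χ (u n)
  filter_upwards [hae, hall, coeFn_transformL2 h χ v] with x h1 h2 h3
  rw [h3]
  refine tendsto_nhds_unique h1 ?_
  refine ((tendsto_fourierInv_mulBCF χ hu x).comp hns.tendsto_atTop).congr fun n => ?_
  exact (h2 (ns n)).symm

lemma exists_eLpNorm_fourierInv_mulBCF_le {m : Measure (Euc d)}
    (h : ∀ f : C_c(Euc d, ℂ), MemLp (𝓕⁻ (f : Euc d → ℂ)) 2 m) (χ : C_c(Euc d, ℂ)) :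
    ∃ C : ℝ, ∀ u : Euc d →ᵇ ℂ,
      eLpNorm (𝓕⁻ (mulBCF χ u : Euc d → ℂ)) 2 m ≤ ENNReal.ofReal (C * ‖u‖) := by
  let T : (Euc d →ᵇ ℂ) →L[ℂ] Lp ℂ 2 m := ⟨transformL2 h χ, continuous_transformL2 h χ⟩
  refine ⟨‖T‖, fun u => ?_⟩
  have h1 := T.le_opNorm u
  rw [Lp.norm_def, ← ENNReal.le_ofReal_iff_toReal_le (Lp.eLpNorm_ne_top _) (by positivity)] at h1
  rw [← eLpNorm_congr_ae (coeFn_transformL2 h χ u)]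
  exact h1

/-- The character `x ↦ exp (-2 π i ⟨x, t⟩)` as a bounded continuous function. -/
def charBCF (t : Euc d) : Euc d →ᵇ ℂ :=
  BoundedContinuousFunction.ofNormedAddCommGroup (fun x => (𝐞 (-inner ℝ x t) : ℂ))
    (continuous_subtype_val.comp (Real.continuous_fourierChar.comp (by fun_prop))) 1
    fun _ => (Circle.norm_coe _).le

lemma norm_charBCF_le (t : Euc d) : ‖charBCF t‖ ≤ 1 :=
  BoundedContinuousFunction.norm_ofNormedAddCommGroup_le _ zero_le_one _

lemma fourierInv_mulBCF_charBCF (χ : C_c(Euc d, ℂ)) (t ξ : Euc d) :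
    𝓕⁻ (mulBCF χ (charBCF t) : Euc d → ℂ) ξ = 𝓕⁻ (χ : Euc d → ℂ) (ξ - t) := by
  rw [Real.fourierInv_eq, Real.fourierInv_eq]
  congr 1 with x
  rw [mulBCF_apply, inner_sub_right, sub_eq_add_neg, AddChar.map_add_eq_mul, mul_smul]
  simp only [Circle.smul_def, smul_eq_mul]
  rw [mul_comm (χ x)]
  rfl

/-- The translates of `𝓕⁻ χ` are transforms of `χ` times characters, hence uniformly bounded in
`L²`. Chebyshev's inequality at level `1/2` applies on the neighbourhood `U` where `|𝓕⁻ χ| ≥ 1/2`,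
which is available since `𝓕⁻ χ 0 = ∫ χ = 1`. -/
lemma exists_measure_translate_le {m : Measure (Euc d)}
    (h : ∀ f : C_c(Euc d, ℂ), MemLp (𝓕⁻ (f : Euc d → ℂ)) 2 m) :
    ∃ U ∈ 𝓝 (0 : Euc d), ∃ C : ℝ≥0∞, C ≠ ∞ ∧ ∀ t, m {x | x - t ∈ U} ≤ C := by
  set χ := mollifier d 0
  obtain ⟨C, hC⟩ := exists_eLpNorm_fourierInv_mulBCF_le h χ
  have h0 : 𝓕⁻ (χ : Euc d → ℂ) 0 = 1 := by
    rw [fourierInv_mollifier]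
    simp only [inner_zero_right, AddChar.map_zero_eq_one, Circle.coe_one, mul_one,
      mollifier_apply]
    rw [integral_complex_ofReal, (bump d 0).integral_normed, Complex.ofReal_one]
  have hcont : Continuous fun ξ => ‖𝓕⁻ (χ : Euc d → ℂ) ξ‖ₑ :=
    (continuous_fourierInv (integrable_volume_coe χ)).enorm
  refine ⟨{ξ | (2⁻¹ : ℝ≥0∞) ≤ ‖𝓕⁻ (χ : Euc d → ℂ) ξ‖ₑ}, ?_,
    (2⁻¹ ^ (2 : ℝ≥0∞).toReal)⁻¹ * ENNReal.ofReal |C| ^ (2 : ℝ≥0∞).toReal, ?_, fun t => ?_⟩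
  · have : ∀ᶠ ξ in 𝓝 (0 : Euc d), (2⁻¹ : ℝ≥0∞) < ‖𝓕⁻ (χ : Euc d → ℂ) ξ‖ₑ := by
      refine hcont.continuousAt.eventually_const_lt ?_
      simp [h0]
    filter_upwards [this] with ξ hξ using hξ.le
  · refine ENNReal.mul_ne_top ?_ ?_
    · simp
    · simp
  · have h1 := mul_meas_ge_le_pow_eLpNorm' m (p := 2) two_ne_zero ENNReal.ofNat_ne_top
      (h (mulBCF χ (charBCF t))).1 2⁻¹
    simp only [fourierInv_mulBCF_charBCF] at h1
    rw [← ENNReal.div_eq_inv_mul, ENNReal.le_div_iff_mul_le (by simp) (by simp), mul_comm]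
    refine h1.trans ?_
    have h2 := hC (charBCF t)
    have h3 : ENNReal.ofReal (C * ‖charBCF t‖) ≤ ENNReal.ofReal |C| := by
      refine ENNReal.ofReal_le_ofReal ?_
      calc C * ‖charBCF t‖ ≤ |C| * ‖charBCF t‖ := by gcongr; exact le_abs_self C
        _ ≤ |C| := mul_le_of_le_one_right (abs_nonneg C) (norm_charBCF_le t)
    exact ENNReal.rpow_le_rpow (h2.trans h3) (by simp)

/-- A Fourier transform is translation bounded. -/
theorem IsFourierTransform.translationBounded {μ ν : ComplexRadonMeasure (Euc d)}
    (h : μ.IsFourierTransform ν) : ν.TranslationBounded := by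
  obtain ⟨U, hU, C, hC, hUC⟩ := exists_measure_translate_le fun f => (h f).1
  intro K hK
  -- A finite cover of `K` by translates of `U`, moved by `t`, covers `t + K`; the number of sets
  -- does not depend on `t`.
  obtain ⟨s, -, hs⟩ := hK.elim_nhds_subcover (fun k => {x | x - k ∈ U}) fun k _ => by
    have : Tendsto (fun x : Euc d => x - k) (𝓝 k) (𝓝 (k - k)) := (continuous_sub_right k).tendsto k
    rw [sub_self] at this
    exact this hU
  refine lt_of_le_of_lt (b := s.card * C) (iSup_le fun t => ?_)
    (ENNReal.mul_lt_top (by simp) hC.lt_top)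
  have h1 : (fun x => t + x) '' K ⊆ ⋃ k ∈ s, {x | x - (t + k) ∈ U} := by
    rintro _ ⟨x, hx, rfl⟩
    obtain ⟨k, hk, hxk⟩ := Set.mem_iUnion₂.mp (hs hx)
    refine Set.mem_iUnion₂.mpr ⟨k, hk, ?_⟩
    change t + x - (t + k) ∈ U
    rwa [add_sub_add_left_eq_sub]
  refine (measure_mono h1).trans ((measure_biUnion_finset_le _ _).trans ?_)
  refine (Finset.sum_le_sum fun k _ => hUC (t + k)).trans ?_
  simp

/-! ### A weight integrable against translation bounded measures -/

/-- The integrable weight `(1 + ‖x‖)^(-(d + 1))`. -/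
def weight (x : Euc d) : ℝ := ((1 + ‖x‖) ^ (d + 1))⁻¹

lemma weight_pos (x : Euc d) : 0 < weight x := by unfold weight; positivity

lemma continuous_weight : Continuous (weight : Euc d → ℝ) := by
  unfold weight
  exact Continuous.inv₀ (by fun_prop) fun x => by positivity

lemma integrable_weight : Integrable (weight : Euc d → ℝ) := by
  have h := integrable_one_add_norm (E := Euc d) (μ := volume) (r := (d : ℝ) + 1)
    (by simp)
  refine h.congr (.of_forall fun x => ?_)
  change (1 + ‖x‖) ^ (-((d : ℝ) + 1)) = ((1 + ‖x‖) ^ (d + 1))⁻¹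
  rw [Real.rpow_neg (by positivity), ← Real.rpow_natCast]
  push_cast
  rfl

lemma weight_le_mul_weight {x y : Euc d} (h : dist x y < 1) :
    weight x ≤ 2 ^ (d + 1) * weight y := by
  unfold weight
  rw [← div_eq_mul_inv, le_div_iff₀ (by positivity), inv_mul_le_iff₀ (by positivity), ← mul_pow]
  gcongr
  have h1 : ‖y‖ ≤ ‖x‖ + 1 := by
    have := norm_le_norm_add_norm_sub' y x
    rw [← dist_eq_norm, dist_comm] at this
    linarith
  nlinarith [norm_nonneg x]

/-- Uniform integrability of translates of the weight for measures that are bounded on unit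
balls. -/
lemma lintegral_weight_sub_le {m : Measure (Euc d)} [SFinite m] {C : ℝ≥0∞}
    (hC : ∀ t, m (Metric.ball t 1) ≤ C) (t : Euc d) :
    ∫⁻ x, ENNReal.ofReal (weight (x - t)) ∂m ≤
      (volume (Metric.ball (0 : Euc d) 1))⁻¹ *
        (2 ^ (d + 1) * (∫⁻ y : Euc d, ENNReal.ofReal (weight y)) * C) := by
  set v := volume (Metric.ball (0 : Euc d) 1)
  have hv0 : v ≠ 0 := (Metric.measure_ball_pos _ _ one_pos).ne'
  have hvt : v ≠ ∞ := measure_ball_lt_top.ne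
  rw [← ENNReal.div_eq_inv_mul, ENNReal.le_div_iff_mul_le (.inl hv0) (.inl hvt),
    ← lintegral_mul_const _ (by
      exact (continuous_weight.comp (continuous_sub_right t)).measurable.ennreal_ofReal)]
  have hw : Measurable fun y : Euc d => ENNReal.ofReal (weight (y - t)) :=
    (continuous_weight.comp (continuous_sub_right t)).measurable.ennreal_ofReal
  -- The weight at `x` is dominated by its average over the unit ball around `x`, up to `2 ^ (d +
  -- 1)`. Tonelli for this kernel then trades `m` for Lebesgue measure, at the cost of the bound on
  -- unit balls.
  let k : Euc d → Euc d → ℝ≥0∞ := fun x y =>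
    {p : Euc d × Euc d | dist p.1 p.2 < 1}.indicator
      (fun p => 2 ^ (d + 1) * ENNReal.ofReal (weight (p.2 - t))) (x, y)
  have hk : Measurable (Function.uncurry k) := by
    refine Measurable.indicator ((hw.comp measurable_snd).const_mul _) ?_
    exact measurableSet_lt (continuous_fst.dist continuous_snd).measurable measurable_const
  calc ∫⁻ x, ENNReal.ofReal (weight (x - t)) * v ∂m
      ≤ ∫⁻ x, ∫⁻ y, k x y ∂volume ∂m := by
        refine lintegral_mono fun x => ?_
        have hvx : v = volume (Metric.ball x 1) := (Measure.addHaar_ball_center _ x 1).symm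
        rw [hvx, ← setLIntegral_const, ← lintegral_indicator measurableSet_ball]
        refine lintegral_mono fun y => ?_
        by_cases hxy : y ∈ Metric.ball x 1
        · have hxy' : (x, y) ∈ {p : Euc d × Euc d | dist p.1 p.2 < 1} := by
            simpa [dist_comm] using hxy
          rw [Set.indicator_of_mem hxy]
          simp only [k]
          have h2 : (2 : ℝ≥0∞) ^ (d + 1) = ENNReal.ofReal (2 ^ (d + 1)) := by
            rw [ENNReal.ofReal_pow zero_le_two, ENNReal.ofReal_ofNat]
          rw [Set.indicator_of_mem hxy', h2, ← ENNReal.ofReal_mul (by positivity)]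
          refine ENNReal.ofReal_le_ofReal (weight_le_mul_weight ?_)
          rw [dist_sub_right]
          exact hxy'
        · rw [Set.indicator_of_notMem hxy]
          exact zero_le
    _ = ∫⁻ y, ∫⁻ x, k x y ∂m ∂volume := lintegral_lintegral_swap hk.aemeasurable
    _ ≤ ∫⁻ y, 2 ^ (d + 1) * ENNReal.ofReal (weight (y - t)) * C ∂volume := by
        refine lintegral_mono fun y => ?_
        refine le_trans (b := ∫⁻ x, (Metric.ball y 1).indicator
          (fun _ => 2 ^ (d + 1) * ENNReal.ofReal (weight (y - t))) x ∂m) ?_ ?_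
        · exact lintegral_mono fun x => le_rfl
        · rw [lintegral_indicator_const measurableSet_ball]
          gcongr
          exact hC y
    _ = 2 ^ (d + 1) * (∫⁻ y : Euc d, ENNReal.ofReal (weight y)) * C := by
        rw [lintegral_mul_const _ (hw.const_mul _), lintegral_const_mul _ hw,
          lintegral_sub_right_eq_self (fun y => ENNReal.ofReal (weight y)) t]

lemma TranslationBounded.exists_lintegral_weight_sub_le {μ : ComplexRadonMeasure (Euc d)}
    (h : μ.TranslationBounded) :
    ∃ C : ℝ≥0∞, C ≠ ∞ ∧ ∀ t, ∫⁻ x, ENNReal.ofReal (weight (x - t)) ∂μ.variation ≤ C := by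
  have hC := h (Metric.closedBall 0 1) (isCompact_closedBall 0 1)
  have hb : ∀ t, μ.variation (Metric.ball t 1) ≤
      ⨆ t : Euc d, μ.variation ((fun x => t + x) '' Metric.closedBall 0 1) := by
    refine fun t => le_trans (measure_mono fun x hx => ?_)
      (le_iSup (fun t => μ.variation ((fun x => t + x) '' Metric.closedBall 0 1)) t)
    refine ⟨x - t, ?_, add_sub_cancel t x⟩
    rw [mem_closedBall_zero_iff, ← dist_eq_norm]
    exact (Metric.mem_ball.mp hx).le
  refine ⟨_, ?_, lintegral_weight_sub_le hb⟩
  refine ENNReal.mul_ne_top (ENNReal.inv_ne_top.mpr (Metric.measure_ball_pos _ _ one_pos).ne') ?_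
  refine ENNReal.mul_ne_top (ENNReal.mul_ne_top (by simp) ?_) hC.ne
  exact integrable_weight.lintegral_lt_top.ne

lemma TranslationBounded.integrable_weight {μ : ComplexRadonMeasure (Euc d)}
    (h : μ.TranslationBounded) : Integrable (weight : Euc d → ℝ) μ.variation := by
  obtain ⟨C, hC, hle⟩ := h.exists_lintegral_weight_sub_le
  refine ⟨continuous_weight.aestronglyMeasurable, ?_⟩
  rw [hasFiniteIntegral_iff_ofReal (.of_forall fun x => (weight_pos x).le)]
  have h0 := hle 0
  simp only [sub_zero] at h0
  exact h0.trans_lt hC.lt_top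

/-! ### Inversion formula with a dilated cutoff -/

lemma exists_pow_mul_norm_le (φ : 𝓢(Euc d, ℂ)) (k : ℕ) :
    ∃ C, 0 ≤ C ∧ ∀ x, (1 + ‖x‖) ^ k * ‖φ x‖ ≤ C := by
  have h : ∀ x, (1 + ‖x‖) ^ k * ‖φ x‖ ≤ _ := fun x => by
    simpa using SchwartzMap.one_add_le_sup_seminorm_apply (𝕜 := ℝ) (m := (k, 0)) (k := k) (n := 0)
      le_rfl le_rfl φ x
  exact ⟨_, le_trans (by positivity) (h 0), h⟩

/-- Smooth compactly supported functions equal to one on a given ball. -/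
lemma exists_cutoff (d : ℕ) (R : ℝ) :
    ∃ a : 𝓢(Euc d, ℂ), HasCompactSupport a ∧ (∀ x, ‖x‖ ≤ R → a x = 1) ∧ a 0 = 1 ∧
      ∀ x, ‖a x‖ ≤ 1 := by
  -- Using `|R| + 1` keeps the inner radius positive and gives the value one at the origin even for
  -- negative `R`.
  let b : ContDiffBump (0 : Euc d) := ⟨|R| + 1, |R| + 2, by positivity, by linarith⟩
  have h1 : HasCompactSupport fun x => ((b x : ℝ) : ℂ) :=
    b.hasCompactSupport.comp_left Complex.ofReal_zero
  have h3 : ∀ x, ‖x‖ ≤ |R| + 1 → ((b x : ℝ) : ℂ) = 1 := fun x hx => by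
    rw [b.one_of_mem_closedBall (by simpa using hx), Complex.ofReal_one]
  refine ⟨h1.toSchwartzMap (Complex.ofRealCLM.contDiff.comp b.contDiff), h1,
    fun x hx => h3 x (by linarith [le_abs_self R]), h3 0 (by rw [norm_zero]; positivity),
    fun x => ?_⟩
  change ‖((b x : ℝ) : ℂ)‖ ≤ 1
  rw [Complex.norm_real, Real.norm_of_nonneg b.nonneg]
  exact b.le_one

lemma fourier_eq_fourierInv_neg (f : Euc d → ℂ) (ξ : Euc d) : 𝓕 f ξ = 𝓕⁻ f (-ξ) := by
  rw [Real.fourierInv_eq_fourier_neg, neg_neg]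

lemma continuous_fourier {f : Euc d → ℂ} (hf : Integrable f) : Continuous (𝓕 f) := by
  have h2 : 𝓕 f = fun w => 𝓕⁻ f (-w) := by
    ext w; exact fourier_eq_fourierInv_neg f w
  rw [h2]
  exact (continuous_fourierInv hf).comp continuous_neg

/-- The product of the Fourier transform of `f` with the dilated cutoff function `a`. -/
def fourierCutoff (a : 𝓢(Euc d, ℂ)) (ha : HasCompactSupport a) (f : C_c(Euc d, ℂ)) (n : ℕ) :
    C_c(Euc d, ℂ) where
  toFun x := 𝓕 (f : Euc d → ℂ) x * a (((n : ℝ) + 1)⁻¹ • x)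
  continuous_toFun := (continuous_fourier (integrable_volume_coe f)).mul
    (a.continuous.comp (continuous_const_smul _))
  hasCompactSupport' := (ha.comp_smul (by positivity)).mul_left

lemma fourierCutoff_apply (a : 𝓢(Euc d, ℂ)) (ha : HasCompactSupport a) (f : C_c(Euc d, ℂ))
    (n : ℕ) (x : Euc d) :
    fourierCutoff a ha f n x = 𝓕 (f : Euc d → ℂ) x * a (((n : ℝ) + 1)⁻¹ • x) := rfl

lemma fourier_char_mul_dilate (a : 𝓢(Euc d, ℂ)) {s : ℝ} (hs : 0 < s) (ξ y : Euc d) :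
    𝓕 (fun x => (𝐞 (inner ℝ x ξ) : ℂ) * a (s⁻¹ • x)) y =
      s ^ d * 𝓕⁻ (a : Euc d → ℂ) (s • (ξ - y)) := by
  have h := Measure.integral_comp_smul (μ := volume)
    (fun x : Euc d => 𝐞 (inner ℝ x (s • (ξ - y))) • a x) s⁻¹
  rw [finrank_euclideanSpace_fin, inv_pow, inv_inv, abs_of_pos (by positivity)] at h
  rw [Real.fourierInv_eq]
  rw [Complex.real_smul, Complex.ofReal_pow] at h
  rw [← h, Real.fourier_eq]
  congr 1 with x
  rw [inner_smul_left, inner_smul_right, inner_sub_right]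
  simp only [conj_trivial]
  rw [inv_mul_cancel_left₀ hs.ne', sub_eq_neg_add, AddChar.map_add_eq_mul, mul_smul]
  simp only [Circle.smul_def, smul_eq_mul]

lemma integral_fourier_mul_eq {f g : Euc d → ℂ} (hf : Integrable f) (hg : Integrable g) :
    ∫ x, 𝓕 f x * g x = ∫ y, f y * 𝓕 g y := by
  simpa using! VectorFourier.integral_fourierIntegral_smul_eq_flip (L := innerₗ (Euc d))
    Real.continuous_fourierChar continuous_inner hf hg

/-- This is the multiplication formula `∫ 𝓕 f · g = ∫ f · 𝓕 g` for a modulated dilate `g` of `a`,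
followed by the substitution `y = ξ - s⁻¹ • z`. It displays the transform as an average of `f` near
`ξ`. -/
lemma fourierInv_fourierCutoff (a : 𝓢(Euc d, ℂ)) (ha : HasCompactSupport a) (f : C_c(Euc d, ℂ))
    (n : ℕ) (ξ : Euc d) :
    𝓕⁻ (fourierCutoff a ha f n : Euc d → ℂ) ξ =
      ∫ z, f (ξ - ((n : ℝ) + 1)⁻¹ • z) * 𝓕⁻ (a : Euc d → ℂ) z := by
  set s : ℝ := (n : ℝ) + 1
  have hs : 0 < s := by positivity
  set g : Euc d → ℂ := fun x => (𝐞 (inner ℝ x ξ) : ℂ) * a (s⁻¹ • x)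
  have hg : Integrable g := by
    refine Continuous.integrable_of_hasCompactSupport ?_ (ha.comp_smul (by positivity)).mul_left
    refine Continuous.mul ?_ (a.continuous.comp (continuous_const_smul _))
    exact continuous_subtype_val.comp (Real.continuous_fourierChar.comp (by fun_prop))
  have h1 : ∫ x, 𝓕 (f : Euc d → ℂ) x * g x = ∫ y, f y * 𝓕 g y :=
    integral_fourier_mul_eq (integrable_volume_coe f) hg
  have h2 : 𝓕⁻ (fourierCutoff a ha f n : Euc d → ℂ) ξ = ∫ x, 𝓕 (f : Euc d → ℂ) x * g x := by
    rw [Real.fourierInv_eq]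
    congr 1 with x
    rw [Circle.smul_def, fourierCutoff_apply, smul_eq_mul]
    ring
  rw [h2, h1]
  simp only [g, fourier_char_mul_dilate a hs]
  rw [← integral_sub_left_eq_self _ volume ξ]
  have h3 := Measure.integral_comp_smul (μ := volume)
    (fun z : Euc d => f (ξ - s⁻¹ • z) * 𝓕⁻ (a : Euc d → ℂ) z) s
  rw [finrank_euclideanSpace_fin, abs_of_pos (by positivity), eq_inv_smul_iff₀ (by positivity),
    Complex.real_smul, Complex.ofReal_pow, ← integral_const_mul] at h3
  rw [← h3]
  congr 1 with z
  rw [inv_smul_smul₀ hs.ne', sub_sub_cancel]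
  ring

lemma exists_norm_le (f : C_c(Euc d, ℂ)) : ∃ A, 0 ≤ A ∧ ∀ x, ‖f x‖ ≤ A := by
  obtain ⟨A, hA⟩ := f.hasCompactSupport.exists_bound_of_continuous (map_continuous f)
  exact ⟨A, (norm_nonneg _).trans (hA 0), hA⟩

lemma exists_eq_zero_of_lt_norm (f : C_c(Euc d, ℂ)) :
    ∃ R, 0 ≤ R ∧ ∀ x, R < ‖x‖ → f x = 0 := by
  obtain ⟨R, hR⟩ := f.hasCompactSupport.isCompact.isBounded.subset_closedBall 0
  refine ⟨max R 0, le_max_right _ _, fun x hx => ?_⟩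
  by_contra h0
  have := hR (subset_tsupport _ h0)
  rw [mem_closedBall_zero_iff] at this
  exact absurd hx (not_lt.mpr (this.trans (le_max_left _ _)))

/-- If `f (x - s • z)` is nonzero then `‖x‖ ≤ R + ‖z‖`, so `1 + ‖x‖ ≤ (1 + R) * (1 + ‖z‖)`. The
uniformity in `s` supplies a single dominating function for all cutoffs. -/
lemma exists_norm_sub_smul_le (f : C_c(Euc d, ℂ)) :
    ∃ B, 0 ≤ B ∧ ∀ (s : ℝ) (x z : Euc d), 0 ≤ s → s ≤ 1 →
      ‖f (x - s • z)‖ ≤ B * (1 + ‖z‖) ^ (d + 1) * weight x := by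
  obtain ⟨A, hA0, hA⟩ := exists_norm_le f
  obtain ⟨R, hR0, hR⟩ := exists_eq_zero_of_lt_norm f
  refine ⟨A * (1 + R) ^ (d + 1), by positivity, fun s x z hs0 hs1 => ?_⟩
  by_cases h : R < ‖x - s • z‖
  · rw [hR _ h, norm_zero]
    have := weight_pos x
    positivity
  · have h1 : ‖x‖ ≤ R + ‖z‖ := by
      have h2 := norm_le_norm_add_norm_sub' x (s • z)
      have h3 : ‖s • z‖ ≤ ‖z‖ := by
        rw [norm_smul, Real.norm_of_nonneg hs0]
        exact mul_le_of_le_one_left (norm_nonneg z) hs1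
      linarith [not_lt.mp h]
    refine (hA _).trans ?_
    unfold weight
    rw [mul_assoc A, ← mul_pow, mul_assoc, ← div_eq_mul_inv]
    refine le_mul_of_one_le_right hA0 ?_
    rw [one_le_div (by positivity)]
    gcongr
    nlinarith [norm_nonneg z]

lemma integrable_pow_mul_norm (φ : 𝓢(Euc d, ℂ)) (k : ℕ) :
    Integrable fun z => (1 + ‖z‖) ^ k * ‖φ z‖ := by
  obtain ⟨C, hC0, hC⟩ := exists_pow_mul_norm_le φ (k + (d + 1))
  refine (integrable_weight.const_mul C).mono' ?_ (.of_forall fun z => ?_)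
  · exact Continuous.aestronglyMeasurable (by fun_prop)
  · rw [Real.norm_of_nonneg (by positivity)]
    unfold weight
    rw [← div_eq_mul_inv, le_div_iff₀ (by positivity)]
    refine le_trans (le_of_eq ?_) (hC z)
    rw [pow_add]
    ring

/-- The values of a Fourier transform `ν` on `C_c(ℝ^d)` in terms of the measure `μ`. -/
theorem IsFourierTransform.tendsto_apply_fourierCutoff {μ ν : ComplexRadonMeasure (Euc d)}
    (h : μ.IsFourierTransform ν) (a : 𝓢(Euc d, ℂ)) (ha : HasCompactSupport a) (ha0 : a 0 = 1)
    (f : C_c(Euc d, ℂ)) :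
    Tendsto (fun n => μ (fourierCutoff a ha f n)) atTop (𝓝 (ν f)) := by
  obtain ⟨B, hB0, hB⟩ := exists_norm_sub_smul_le f
  set φ : 𝓢(Euc d, ℂ) := 𝓕⁻ a
  have hφ : (φ : Euc d → ℂ) = 𝓕⁻ (a : Euc d → ℂ) := SchwartzMap.fourierInv_coe a
  have hs0 : ∀ n : ℕ, 0 ≤ ((n : ℝ) + 1)⁻¹ := fun n => by positivity
  have hs1 : ∀ n : ℕ, ((n : ℝ) + 1)⁻¹ ≤ 1 := fun n =>
    inv_le_one_of_one_le₀ (by linarith [(Nat.cast_nonneg n : (0 : ℝ) ≤ n)])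
  have hdom : ∀ (n : ℕ) (ξ z : Euc d), ‖f (ξ - ((n : ℝ) + 1)⁻¹ • z) * φ z‖ ≤
      B * weight ξ * ((1 + ‖z‖) ^ (d + 1) * ‖φ z‖) := fun n ξ z => by
    rw [norm_mul]
    refine (mul_le_mul_of_nonneg_right (hB _ ξ z (hs0 n) (hs1 n)) (norm_nonneg _)).trans_eq ?_
    ring
  have hint := integrable_pow_mul_norm φ (d + 1)
  have heq : ∀ n ξ, 𝓕⁻ (fourierCutoff a ha f n : Euc d → ℂ) ξ =
      ∫ z, f (ξ - ((n : ℝ) + 1)⁻¹ • z) * φ z := fun n ξ => by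
    rw [fourierInv_fourierCutoff, hφ]
  set M := ∫ z, (1 + ‖z‖) ^ (d + 1) * ‖φ z‖
  have hle : ∀ n ξ, ‖𝓕⁻ (fourierCutoff a ha f n : Euc d → ℂ) ξ‖ ≤ B * M * weight ξ :=
    fun n ξ => by
    rw [heq]
    refine (norm_integral_le_of_norm_le (hint.const_mul _) (.of_forall (hdom n ξ))).trans_eq ?_
    rw [integral_const_mul]
    ring
  have hb : Integrable (fun ξ : Euc d => B * M * weight ξ) ν.variation :=
    h.translationBounded.integrable_weight.const_mul _
  refine HasIntegral.tendsto_of_dominated (fun n => h.hasIntegral_fourierInv _ ?_)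
    (ν.hasIntegral_coe f) _ hb hle fun ξ => ?_
  · exact hb.mono' (continuous_fourierInv (integrable_volume_coe _)).aestronglyMeasurable
      (.of_forall (hle n))
  -- The averaging kernel has total mass `∫ 𝓕⁻ a = a 0 = 1`, so the averages converge to `f ξ`.
  · have h1 : ∫ z, f ξ * φ z = f ξ := by
      have h2 : ∫ z, φ z = 𝓕 φ 0 := by
        rw [SchwartzMap.fourier_coe, Real.fourier_eq]
        simp
      rw [integral_const_mul, h2, FourierTransform.fourier_fourierInv_eq, ha0, mul_one]
    simp only [heq]
    rw [← h1]
    refine tendsto_integral_of_dominated_convergence _ (fun n => ?_)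
      (hint.const_mul (B * weight ξ)) (fun n => .of_forall (hdom n ξ)) (.of_forall fun z => ?_)
    · exact Continuous.aestronglyMeasurable (by fun_prop)
    · refine Tendsto.mul_const _ (((map_continuous f).tendsto ξ).comp ?_)
      have h3 : Tendsto (fun n : ℕ => ((n : ℝ) + 1)⁻¹) atTop (𝓝 0) := by
        simpa using tendsto_one_div_add_atTop_nhds_zero_nat (𝕜 := ℝ)
      simpa using (h3.smul_const z).const_sub ξ

/-! ### Transforms of convolutions and square integrability -/

lemma fourier_conv (f g : C_c(Euc d, ℂ)) (ξ : Euc d) :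
    𝓕 (conv f g : Euc d → ℂ) ξ = 𝓕 (f : Euc d → ℂ) ξ * 𝓕 (g : Euc d → ℂ) ξ :=
  Real.fourier_mul_convolution_eq (integrable_volume_coe f) (integrable_volume_coe g) ξ

lemma fourierInv_conv (f g : C_c(Euc d, ℂ)) (ξ : Euc d) :
    𝓕⁻ (conv f g : Euc d → ℂ) ξ = 𝓕⁻ (f : Euc d → ℂ) ξ * 𝓕⁻ (g : Euc d → ℂ) ξ := by
  simp only [Real.fourierInv_eq_fourier_neg, fourier_conv]

lemma fourierInv_reflectFun (f : C_c(Euc d, ℂ)) (ξ : Euc d) :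
    𝓕⁻ (reflectFun f : Euc d → ℂ) ξ = 𝓕⁻ (f : Euc d → ℂ) (-ξ) := by
  rw [Real.fourierInv_eq, Real.fourierInv_eq, ← integral_neg_eq_self]
  congr 1 with x
  simp

lemma fourierInv_tildeFun (f : C_c(Euc d, ℂ)) (ξ : Euc d) :
    𝓕⁻ (tildeFun f : Euc d → ℂ) ξ = star (𝓕⁻ (f : Euc d → ℂ) ξ) := by
  rw [Real.fourierInv_eq, Real.fourierInv_eq, ← integral_neg_eq_self, RCLike.star_def,
    ← integral_conj]
  congr 1 with x
  rw [tildeFun_apply, inner_neg_left, neg_neg, AddChar.map_neg_eq_inv]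
  simp only [Circle.smul_def, smul_eq_mul, map_mul, Circle.coe_inv_eq_conj, RCLike.star_def]

/-- Smoothness makes the mollified function Schwartz, so that Plancherel applies to it. -/
lemma contDiff_conv_mollifier (f : C_c(Euc d, ℂ)) (n : ℕ) :
    ContDiff ℝ (⊤ : ℕ∞) (conv f (tildeFun (mollifier d n)) : Euc d → ℂ) := by
  refine HasCompactSupport.contDiff_convolution_right (μ := volume) (ContinuousLinearMap.mul ℝ ℂ)
    (tildeFun (mollifier d n)).hasCompactSupport (map_continuous f).locallyIntegrable ?_
  have h : (tildeFun (mollifier d n) : Euc d → ℂ) =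
      fun x => (((bump d n).normed volume (-x) : ℝ) : ℂ) := by
    ext x
    simp [mollifier_apply]
  rw [h]
  exact Complex.ofRealCLM.contDiff.comp ((bump d n).contDiff_normed.comp contDiff_neg)

lemma eLpNorm_fourierInv_schwartz (φ : 𝓢(Euc d, ℂ)) :
    eLpNorm (𝓕⁻ (φ : Euc d → ℂ)) 2 volume = eLpNorm (φ : Euc d → ℂ) 2 volume := by
  have h := SchwartzMap.norm_fourier_toL2_eq (𝓕⁻ φ)
  rw [FourierTransform.fourier_fourierInv_eq, SchwartzMap.norm_toLp, SchwartzMap.norm_toLp,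
    ENNReal.toReal_eq_toReal_iff' (φ.memLp 2 volume).2.ne ((𝓕⁻ φ).memLp 2 volume).2.ne,
    SchwartzMap.fourierInv_coe] at h
  exact h.symm

lemma norm_conv_mollifier_le {f : C_c(Euc d, ℂ)} {A : ℝ} (hA : ∀ x, ‖f x‖ ≤ A) (n : ℕ)
    (x : Euc d) : ‖conv f (tildeFun (mollifier d n)) x‖ ≤ A := by
  rw [conv_tildeFun_mollifier_apply]
  exact norm_integral_mollifier_mul_le fun y _ => hA _

/-- The Fourier transform of a function in `C_c(ℝ^d)` is square integrable. -/
lemma memLp_fourierInv_volume (f : C_c(Euc d, ℂ)) :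
    MemLp (𝓕⁻ (f : Euc d → ℂ)) 2 (volume : Measure (Euc d)) := by
  refine ⟨(continuous_fourierInv (integrable_volume_coe f)).aestronglyMeasurable, ?_⟩
  obtain ⟨A, hA0, hA⟩ := exists_norm_le f
  set K := Metric.cthickening 1 (tsupport f)
  have hK : IsCompact K := f.hasCompactSupport.isCompact.cthickening
  have hmem : MemLp (K.indicator fun _ => A) 2 (volume : Measure (Euc d)) :=
    memLp_indicator_const 2 hK.measurableSet A (.inr hK.measure_lt_top.ne)
  have hle : ∀ n, eLpNorm (𝓕⁻ (conv f (tildeFun (mollifier d n)) : Euc d → ℂ)) 2 volume ≤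
      eLpNorm (K.indicator fun _ => A) 2 (volume : Measure (Euc d)) := by
    intro n
    let φ : 𝓢(Euc d, ℂ) := (conv f (tildeFun (mollifier d n))).hasCompactSupport.toSchwartzMap
      (contDiff_conv_mollifier f n)
    refine (eLpNorm_fourierInv_schwartz φ).trans_le (eLpNorm_mono fun x => ?_)
    change ‖conv f (tildeFun (mollifier d n)) x‖ ≤ _
    by_cases hx : x ∈ K
    · rw [Set.indicator_of_mem hx, Real.norm_of_nonneg hA0]
      exact norm_conv_mollifier_le hA n x
    · rw [conv_mollifier_eq_zero hx, norm_zero]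
      exact norm_nonneg _
  refine lt_of_le_of_lt ?_ hmem.2
  -- Fatou's lemma carries the uniform Plancherel bound from the mollified functions to `f`.
  refine (Lp.eLpNorm_lim_le_liminf_eLpNorm
    (f := fun n => 𝓕⁻ (conv f (tildeFun (mollifier d n)) : Euc d → ℂ))
    (fun n => (continuous_fourierInv (integrable_volume_coe _)).aestronglyMeasurable) _
    (.of_forall fun ξ => ?_)).trans ?_
  · simp only [fourierInv_conv, fourierInv_tildeFun]
    simpa using (tendsto_fourierInv_mollifier ξ).star.const_mul (𝓕⁻ (f : Euc d → ℂ) ξ)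
  · exact liminf_le_of_le (by isBoundedDefault) fun b hb => by
      obtain ⟨n, hn⟩ := hb.exists
      exact hn.trans (hle n)

/-- Cauchy–Schwarz for the measure with density `w`, obtained from Hölder applied to `w` and `w u²`
with both exponents `1/2`. -/
lemma lintegral_mul_sq_le {α : Type*} [MeasurableSpace α] {κ : Measure α} {w u : α → ℝ≥0∞}
    (hw : Measurable w) (hu : Measurable u) :
    (∫⁻ x, w x * u x ∂κ) ^ (2 : ℝ) ≤ (∫⁻ x, w x ∂κ) * ∫⁻ x, w x * u x ^ (2 : ℝ) ∂κ := by
  have h := ENNReal.lintegral_mul_norm_pow_le (μ := κ) (f := w) (g := fun x => w x * u x ^ (2 : ℝ))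
    hw.aemeasurable (hw.mul (hu.pow_const _)).aemeasurable (p := 1 / 2) (q := 1 / 2)
    (by norm_num) (by norm_num) (by norm_num)
  have h1 : ∀ x, w x ^ (1 / 2 : ℝ) * (w x * u x ^ (2 : ℝ)) ^ (1 / 2 : ℝ) = w x * u x := fun x => by
    rw [ENNReal.mul_rpow_of_nonneg _ _ (by norm_num), ← mul_assoc,
      ← ENNReal.rpow_add_of_nonneg _ _ (by norm_num) (by norm_num), ← ENNReal.rpow_mul]
    norm_num
  simp only [h1] at h
  refine (ENNReal.rpow_le_rpow h zero_le_two).trans_eq ?_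
  rw [ENNReal.mul_rpow_of_nonneg _ _ zero_le_two, ← ENNReal.rpow_mul, ← ENNReal.rpow_mul]
  norm_num

/-- A reproducing formula for the Fourier transform of a compactly supported function. -/
lemma exists_fourierInv_eq_integral (f : C_c(Euc d, ℂ)) :
    ∃ b : 𝓢(Euc d, ℂ), ∀ ξ, 𝓕⁻ (f : Euc d → ℂ) ξ =
      ∫ ζ, b (ξ - ζ) * 𝓕⁻ (f : Euc d → ℂ) ζ := by
  obtain ⟨R, -, hR⟩ := exists_eq_zero_of_lt_norm f
  obtain ⟨a, -, ha, -⟩ := exists_cutoff d R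
  refine ⟨𝓕⁻ a, fun ξ => ?_⟩
  -- Since `a = 1` on the support of `f`, multiplying by `a` changes nothing; on the transform side
  -- this is convolution with `𝓕⁻ a`.
  set g := mulBCF f (charBCF (-ξ))
  have hg : ∀ ζ, 𝓕 (g : Euc d → ℂ) ζ = 𝓕⁻ (f : Euc d → ℂ) (ξ - ζ) := fun ζ => by
    rw [fourier_eq_fourierInv_neg, fourierInv_mulBCF_charBCF]
    rw [sub_neg_eq_add, neg_add_eq_sub]
  have h1 : ∫ x, 𝓕 (𝓕⁻ a) x * g x = ∫ ζ, (𝓕⁻ a) ζ * 𝓕 (g : Euc d → ℂ) ζ := by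
    exact integral_fourier_mul_eq (SchwartzMap.integrable (𝓕⁻ a)) (integrable_volume_coe g)
  rw [← integral_sub_left_eq_self _ volume ξ]
  simp only [sub_sub_cancel, ← hg]
  rw [← h1, FourierTransform.fourier_fourierInv_eq, Real.fourierInv_eq]
  congr 1 with x
  rw [mulBCF_apply, Circle.smul_def, smul_eq_mul]
  have h2 : charBCF (-ξ) x = (𝐞 (inner ℝ x ξ) : ℂ) := by
    change (𝐞 (-inner ℝ x (-ξ)) : ℂ) = _
    rw [inner_neg_right, neg_neg]
  rw [h2]
  by_cases hx : R < ‖x‖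
  · rw [hR x hx]
    simp
  · rw [ha x (not_lt.mp hx)]
    ring

/-- The reproducing formula and Cauchy–Schwarz bound `|𝓕⁻ f|²` by its convolution with a multiple of
the weight. Integrating against `|μ|` and exchanging integrals, the translates of the weight
contribute a uniform constant, which leaves the Lebesgue `L²` norm. -/
lemma TranslationBounded.memLp_fourierInv {μ : ComplexRadonMeasure (Euc d)}
    (h : μ.TranslationBounded) (f : C_c(Euc d, ℂ)) :
    MemLp (𝓕⁻ (f : Euc d → ℂ)) 2 μ.variation := by
  have hcont := continuous_fourierInv (integrable_volume_coe f)
  refine ⟨hcont.aestronglyMeasurable, ?_⟩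
  rw [eLpNorm_lt_top_iff_lintegral_rpow_enorm_lt_top two_ne_zero ENNReal.ofNat_ne_top,
    ENNReal.toReal_ofNat]
  have hvol := (memLp_fourierInv_volume f).2
  rw [eLpNorm_lt_top_iff_lintegral_rpow_enorm_lt_top two_ne_zero ENNReal.ofNat_ne_top,
    ENNReal.toReal_ofNat] at hvol
  obtain ⟨C', hC', hwt⟩ := h.exists_lintegral_weight_sub_le
  obtain ⟨b, hb⟩ := exists_fourierInv_eq_integral f
  obtain ⟨C, hC0, hC⟩ := exists_pow_mul_norm_le b (d + 1)
  set F := 𝓕⁻ (f : Euc d → ℂ)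
  have hFm : Measurable fun ζ => ‖F ζ‖ₑ := hcont.measurable.enorm
  let w : Euc d → ℝ≥0∞ := fun ξ => ENNReal.ofReal C * ENNReal.ofReal (weight ξ)
  have hwm : Measurable w := continuous_weight.measurable.ennreal_ofReal.const_mul _
  have hbw : ∀ ξ, ‖b ξ‖ₑ ≤ w ξ := fun ξ => by
    simp only [w]
    rw [← ofReal_norm, ← ENNReal.ofReal_mul hC0]
    refine ENNReal.ofReal_le_ofReal ?_
    unfold weight
    rw [← div_eq_mul_inv, le_div_iff₀ (by positivity), mul_comm]
    exact hC ξ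
  set I := ∫⁻ ζ, w ζ
  have hI : I ≠ ∞ := by
    refine ne_of_eq_of_ne (lintegral_const_mul _ continuous_weight.measurable.ennreal_ofReal) ?_
    exact ENNReal.mul_ne_top ENNReal.ofReal_ne_top
      ComplexRadonMeasure.integrable_weight.lintegral_lt_top.ne
  have hpt : ∀ ξ, ‖F ξ‖ₑ ^ (2 : ℝ) ≤ I * ∫⁻ ζ, w (ξ - ζ) * ‖F ζ‖ₑ ^ (2 : ℝ) := fun ξ => by
    have h1 : ‖F ξ‖ₑ ≤ ∫⁻ ζ, w (ξ - ζ) * ‖F ζ‖ₑ := by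
      rw [hb ξ]
      refine (enorm_integral_le_lintegral_enorm _).trans (lintegral_mono fun ζ => ?_)
      rw [enorm_mul]
      gcongr
      exact hbw _
    refine (ENNReal.rpow_le_rpow h1 zero_le_two).trans ?_
    refine (lintegral_mul_sq_le (hwm.comp (measurable_const.sub measurable_id)) hFm).trans_eq ?_
    congr 1
    exact lintegral_sub_left_eq_self w ξ
  have hm : Measurable (Function.uncurry fun ξ ζ => w (ξ - ζ) * ‖F ζ‖ₑ ^ (2 : ℝ)) :=
    (hwm.comp (measurable_fst.sub measurable_snd)).mul
      ((hFm.comp measurable_snd).pow_const _)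
  calc ∫⁻ ξ, ‖F ξ‖ₑ ^ (2 : ℝ) ∂μ.variation
      ≤ ∫⁻ ξ, I * ∫⁻ ζ, w (ξ - ζ) * ‖F ζ‖ₑ ^ (2 : ℝ) ∂volume ∂μ.variation := lintegral_mono hpt
    _ = I * ∫⁻ ζ, ∫⁻ ξ, w (ξ - ζ) * ‖F ζ‖ₑ ^ (2 : ℝ) ∂μ.variation ∂volume := by
        rw [lintegral_const_mul' _ _ hI, lintegral_lintegral_swap hm.aemeasurable]
    _ ≤ I * ∫⁻ ζ, (ENNReal.ofReal C * C') * ‖F ζ‖ₑ ^ (2 : ℝ) ∂volume := by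
        gcongr with ζ
        have hwζ : Measurable fun ξ => w (ξ - ζ) := hwm.comp (measurable_id.sub_const ζ)
        rw [lintegral_mul_const _ hwζ]
        gcongr
        simp only [w]
        rw [lintegral_const_mul' _ _ ENNReal.ofReal_ne_top]
        gcongr
        exact hwt ζ
    _ < ∞ := by
        rw [lintegral_const_mul _ (hFm.pow_const _)]
        exact ENNReal.mul_lt_top hI.lt_top
          (ENNReal.mul_lt_top (ENNReal.mul_lt_top ENNReal.ofReal_lt_top hC'.lt_top) hvol)

/-! ### Duality, uniqueness and double transforms -/

/-- Once `𝓕 g` is `|μ|`-integrable it dominates its own cutoffs, so the limit in the inversion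
formula can be taken inside `μ`. -/
lemma IsFourierTransform.apply_eq_of_hasIntegral {μ ν : ComplexRadonMeasure (Euc d)}
    (h : μ.IsFourierTransform ν) {g : C_c(Euc d, ℂ)} {c : ℂ}
    (hg : μ.HasIntegral (𝓕 (g : Euc d → ℂ)) c) : ν g = c := by
  obtain ⟨a, ha, -, ha0, ha1⟩ := exists_cutoff d 0
  refine tendsto_nhds_unique (h.tendsto_apply_fourierCutoff a ha ha0 g) ?_
  refine HasIntegral.tendsto_of_dominated (fun n => μ.hasIntegral_coe (fourierCutoff a ha g n)) hg
    _ hg.integrable.norm (fun n x => ?_) fun x => ?_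
  · rw [fourierCutoff_apply, norm_mul]
    exact mul_le_of_le_one_right (norm_nonneg _) (ha1 _)
  · simp only [fourierCutoff_apply]
    have h3 : Tendsto (fun n : ℕ => ((n : ℝ) + 1)⁻¹ • x) atTop (𝓝 0) := by
      have : Tendsto (fun n : ℕ => ((n : ℝ) + 1)⁻¹) atTop (𝓝 0) := by
        simpa using tendsto_one_div_add_atTop_nhds_zero_nat (𝕜 := ℝ)
      simpa using this.smul_const x
    have h4 := ((a.continuous.tendsto 0).comp h3).const_mul (𝓕 (g : Euc d → ℂ) x)
    rwa [ha0, mul_one] at h4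

/-- The Fourier transform of a measure is unique. -/
theorem IsFourierTransform.unique {μ ν ν' : ComplexRadonMeasure (Euc d)}
    (h : μ.IsFourierTransform ν) (h' : μ.IsFourierTransform ν') : ν = ν' := by
  obtain ⟨a, ha, -, ha0, -⟩ := exists_cutoff d 0
  exact ext_apply fun f => tendsto_nhds_unique (h.tendsto_apply_fourierCutoff a ha ha0 f)
    (h'.tendsto_apply_fourierCutoff a ha ha0 f)

lemma fourier_conv_tildeFun (f g : C_c(Euc d, ℂ)) (ξ : Euc d) :
    𝓕 (conv f (tildeFun g) : Euc d → ℂ) ξ =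
      𝓕⁻ (f : Euc d → ℂ) (-ξ) * star (𝓕⁻ (g : Euc d → ℂ) (-ξ)) := by
  rw [fourier_eq_fourierInv_neg, fourierInv_conv, fourierInv_tildeFun]

lemma reflectFun_conv_tildeFun (f g : C_c(Euc d, ℂ)) :
    reflectFun (conv f (tildeFun g)) = conv (reflectFun f) (tildeFun (reflectFun g)) := by
  ext x
  rw [reflectFun_apply, conv_apply, conv_apply, ← integral_neg_eq_self]
  congr 1 with y
  simp only [reflectFun_apply, tildeFun_apply]
  congr 3
  abel

/-- Inversion for a translation bounded transformable measure. -/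
theorem IsFourierTransform.reflect_of_translationBounded {μ ν : ComplexRadonMeasure (Euc d)}
    (h : μ.IsFourierTransform ν) (hμ : μ.TranslationBounded) :
    ν.IsFourierTransform μ.reflect := by
  intro f
  have hL2 := hμ.reflect.memLp_fourierInv f
  refine ⟨hL2, ?_⟩
  have hint : Integrable (fun ξ => ((‖𝓕⁻ (f : Euc d → ℂ) ξ‖ ^ 2 : ℝ) : ℂ))
      μ.reflect.variation := (hL2.integrable_norm_pow two_ne_zero).ofReal
  obtain ⟨c, hc⟩ := μ.reflect.exists_hasIntegral hint
  -- Reflected back to `μ`, the integrand becomes `|𝓕⁻ f (-ξ)|²`, which is `𝓕 (f * f~)`.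
  have hc' := hc.reflect
  rw [reflect_reflect] at hc'
  rw [h.apply_eq_of_hasIntegral (g := selfConv f) (c := c)]
  · exact hc
  · convert hc' using 1
    ext ξ
    rw [selfConv_eq_conv, fourier_conv_tildeFun, RCLike.star_def, Complex.mul_conj,
      Complex.normSq_eq_norm_sq]

/-- The double Fourier transform, if it exists, is the reflected measure. -/
theorem IsFourierTransform.eq_reflect {μ ν ρ : ComplexRadonMeasure (Euc d)}
    (h : μ.IsFourierTransform ν) (h' : ν.IsFourierTransform ρ) : ρ = μ.reflect := by
  refine ext_apply fun f => ?_
  -- It suffices to compare the two measures on `f * g~` with `g` a mollifier. The polarized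
  -- identity for `μ` and `ν` makes the transform of this function `|ν|`-integrable and evaluates
  -- it, without assuming that `μ` is translation bounded.
  refine tendsto_nhds_unique (ρ.tendsto_apply_conv_mollifier f)
    ((μ.reflect.tendsto_apply_conv_mollifier f).congr fun n => ?_)
  refine (h'.apply_eq_of_hasIntegral ?_).symm
  rw [reflect_apply, reflectFun_conv_tildeFun]
  convert h.hasIntegral_mul (reflectFun f) (reflectFun (mollifier d n)) using 1
  ext ξ
  rw [fourier_conv_tildeFun, fourierInv_reflectFun, fourierInv_reflectFun]

/-- A transform of `ν` is translation bounded like every Fourier transform, and it is `μ†`;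
reflecting gives the bound for `μ`. -/
theorem IsFourierTransform.transformable_iff {μ ν : ComplexRadonMeasure (Euc d)}
    (h : μ.IsFourierTransform ν) : ν.Transformable ↔ μ.TranslationBounded := by
  refine ⟨fun ⟨ρ, hρ⟩ => ?_, fun hμ => ⟨_, h.reflect_of_translationBounded hμ⟩⟩
  have h1 := hρ.translationBounded
  rw [h.eq_reflect hρ] at h1
  simpa using h1.reflect

lemma exists_fourierTransform (μ : TransformableTB d) :
    ∃ ν : TransformableTB d, μ.1.IsFourierTransform ν.1 := by
  obtain ⟨ν, hν⟩ := μ.2.1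
  exact ⟨⟨ν, hν.transformable_iff.mpr μ.2.2, hν.translationBounded⟩, hν⟩

end ComplexRadonMeasure

end

theorem mainTheorem8 (d : ℕ) :
    (∀ μ : ComplexRadonMeasure (ComplexRadonMeasure.Euc d), μ.Transformable →
      ∃! ν : ComplexRadonMeasure (ComplexRadonMeasure.Euc d), μ.IsFourierTransform ν) ∧
    (∀ μ ν : ComplexRadonMeasure (ComplexRadonMeasure.Euc d), μ.IsFourierTransform ν →
      (ν.Transformable ↔ μ.TranslationBounded) ∧
      (ν.Transformable ∨ μ.TranslationBounded →
        ∀ ρ : ComplexRadonMeasure (ComplexRadonMeasure.Euc d),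
          ν.IsFourierTransform ρ ↔ ρ = μ.reflect)) ∧
    (∃ F : ComplexRadonMeasure.TransformableTB d → ComplexRadonMeasure.TransformableTB d,
      (∀ (μ : ComplexRadonMeasure.TransformableTB d)
          (ν : ComplexRadonMeasure (ComplexRadonMeasure.Euc d)),
        μ.1.IsFourierTransform ν ↔ ν = (F μ).1) ∧
      Function.Bijective F) := by
  open ComplexRadonMeasure in
  refine ⟨fun μ ⟨ν, hν⟩ => ⟨ν, hν, fun ν' hν' => hν'.unique hν⟩, fun μ ν h =>
    ⟨h.transformable_iff, fun hor ρ => ⟨fun hρ => h.eq_reflect hρ, ?_⟩⟩, ?_⟩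
  · rintro rfl
    exact h.reflect_of_translationBounded (hor.elim h.transformable_iff.mp id)
  · choose F hF using exists_fourierTransform (d := d)
    have hFF : ∀ μ, (F (F μ)).1 = μ.1.reflect := fun μ => (hF μ).eq_reflect (hF (F μ))
    -- Since `F ∘ F` is reflection, the fourth iterate of `F` is the identity, and the third iterate
    -- supplies preimages.
    refine ⟨F, fun μ ν => ⟨fun h => h.unique (hF μ), fun h => h ▸ hF μ⟩, fun μ μ' h => ?_,
      fun ν => ⟨F (F (F ν)), ?_⟩⟩
    · have h1 := hFF μ
      rw [h, hFF μ'] at h1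
      refine Subtype.ext ?_
      rw [← reflect_reflect μ.1, ← h1, reflect_reflect]
    · refine Subtype.ext ?_
      rw [hFF, hFF, reflect_reflect]
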